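/- Let $0<\mu<1$, $\alpha=\frac{1+\mu}{2\mu}$, $\delta=\frac{1-\mu}{2\mu}$, let $N\ge 1$ and $\nu\ge 0$ be integers, and let $I_\kappa$, $K_\kappa$ denote the modified Bessel functions of the first and second kind. For $x>0$ and $j\ge 0$ put $$\psi_j(x)=x^{j/2}I_j(2\delta\sqrt x),\qquad \varphi_j(x)=x^{(j+\nu)/2}K_{j+\nu}(2\alpha\sqrt x),$$ $$g_{k,l}=\int_0^\infty \psi_l(x)\varphi_k(x)\,dx\quad(0\le k,l\le N-1),\qquad (c_{k,l})_{k,l=0}^{N-1}=\big((g_{k,l})_{k,l=0}^{N-1}\big)^{-1},$$ and let $$K_N(x,y)=\sum_{k,l=0}^{N-1}c_{k,l}\,\psi_k(x)\,\varphi_l(y)$$ be the correlation kernel of the biorthogonal ensemble on $(0,\infty)^N$ with joint density proportional to $\det[\psi_{j-1}(y_i)]_{i,j=1}^N\det[\varphi_{j-1}(y_i)]_{i,j=1}^N$. Let $\Sigma$ be a closed piecewise $C^1$ contour in $\mathbb C$ that encircles $0,1,\dots,N-1$ once in the positive direction (it avoids these points and has winding number $1$ about each of them), and let $c>0$ be such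 that $\Sigma$ does not meet any of the lines $\operatorname{Re} t=c-1+j$, $j=0,1,\dots,N-1$. Then for all $x,y>0$ $$K_N(x,y)=\sum_{k=0}^{N-1}K_N^{(k)}(x,y)\left(\frac{\delta}{\alpha}\right)^{2k},$$ where $$\begin{aligned}K_N^{(k)}(x,y)=\sum_{m=0}^{k}\frac{(-1)^m}{(2\pi i)^2}\binom{N}{m}\oint_\Sigma dt\int_{c-i\infty}^{c+i\infty}ds\;&\frac{\Gamma(s)^2\,\Gamma(s+\nu+k)\,\Gamma(s-t+m-1)\,\Gamma(t-N+1)}{\Gamma(t+1)^2\,\Gamma(t+\nu+1)\,\Gamma(s-N+m)\,\Gamma(s-t+k)}\\ &\times\Big(1-\frac{\delta^2}{\alpha^2}\Big)^{\nu}(\alpha^2-\delta^2)^{t+1}\,x^{t}\;{}_0F_1\!\left(\begin{matrix}-\\ t+1\end{matrix}\,\Big|\,\delta^2x\right)(\alpha^2y)^{-s},\end{aligned}$$ and all these integrals over $s$ and $t$ converge absolutely. (At points where the integrand has a removable singularity it may be given any value.) -/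

import Mathlib

open scoped Nat

noncomputable section

namespace CoupledGaussian

/-! ### Parameters, Bessel functions and the correlation kernel -/

/-- `α(μ) = (1 + μ) / (2 μ)`. -/
def alpha (μ : ℝ) : ℝ := (1 + μ) / (2 * μ)

/-- `δ(μ) = (1 - μ) / (2 μ)`. -/
def delta (μ : ℝ) : ℝ := (1 - μ) / (2 * μ)

/-- The modified Bessel function of the first kind `I_κ` of order `κ = 0, 1, 2, …`. -/
def besselI (κ : ℕ) (z : ℝ) : ℝ :=
  ∑' m : ℕ, 1 / ((m ! : ℝ) * Real.Gamma (κ + m + 1)) * (z / 2) ^ (2 * m + κ)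

/-- The modified Bessel function of the second kind `K_κ` of order `κ = 0, 1, 2, …` at `z > 0`,
by the absolutely convergent integral
`K_κ(z) = (1/2) (z/2)^κ ∫_0^∞ exp(-t - z²/(4t)) t^{-κ-1} dt`. -/
def besselK (κ : ℕ) (z : ℝ) : ℝ :=
  1 / 2 * (z / 2) ^ κ *
    ∫ t in Set.Ioi (0 : ℝ), Real.exp (-t - z ^ 2 / (4 * t)) / t ^ (κ + 1)

/-- `ψ_j(x) = x^{j/2} I_j(2 δ(μ) √x)`. -/
def psi (μ : ℝ) (j : ℕ) (x : ℝ) : ℝ :=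
  x ^ ((j : ℝ) / 2) * besselI j (2 * delta μ * √x)

/-- `φ_j(x) = x^{(j+ν)/2} K_{j+ν}(2 α(μ) √x)`. -/
def phi (ν : ℕ) (μ : ℝ) (j : ℕ) (x : ℝ) : ℝ :=
  x ^ (((j : ℝ) + ν) / 2) * besselK (j + ν) (2 * alpha μ * √x)

/-- The matrix `g_{k,l} = ∫_0^∞ ψ_l(x) φ_k(x) dx`, `0 ≤ k, l ≤ N - 1`. -/
def gramMatrix (N ν : ℕ) (μ : ℝ) : Matrix (Fin N) (Fin N) ℝ :=
  Matrix.of fun k l => ∫ x in Set.Ioi (0 : ℝ), psi μ l x * phi ν μ k x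

/-- The correlation kernel `K_N(x,y) = ∑_{k,l} c_{k,l} ψ_k(x) φ_l(y)`, where `(c_{k,l})` is the
inverse of the matrix `(g_{k,l})`, of the biorthogonal ensemble on `(0,∞)^N` whose joint density is
proportional to `det[ψ_{j-1}(y_i)] det[φ_{j-1}(y_i)]`. -/
def correlationKernel (N ν : ℕ) (μ : ℝ) (x y : ℝ) : ℝ :=
  ∑ k : Fin N, ∑ l : Fin N, (gramMatrix N ν μ)⁻¹ k l * psi μ k x * phi ν μ l y

/-! ### Contour integrals -/

/-- A path is piecewise `C¹` if `[0,1]` splits into finitely many closed intervals on each of which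
it is continuously differentiable (with one-sided derivatives at the end points). -/
def IsPiecewiseC1 {p q : ℂ} (γ : Path p q) : Prop :=
  ∃ (n : ℕ) (τ : ℕ → ℝ), Monotone τ ∧ τ 0 = 0 ∧ τ n = 1 ∧
    ∀ i < n, ContDiffOn ℝ 1 γ.extend (Set.Icc (τ i) (τ (i + 1)))

/-- The `ℂ`-linear form `f(t) dt`. -/
def oneForm (f : ℂ → ℂ) (t : ℂ) : ℂ →L[ℂ] ℂ :=
  ContinuousLinearMap.toSpanSingleton ℂ (f t)

/-- `∫_γ f(t) dt`. -/
def contourIntegral {p q : ℂ} (γ : Path p q) (f : ℂ → ℂ) : ℂ :=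
  curveIntegral (oneForm f) γ

/-- The winding number `(2πi)⁻¹ ∮_γ dt / (t - z)` of a closed path about a point off the path. -/
def windingNumber {p : ℂ} (γ : Path p p) (z : ℂ) : ℂ :=
  (2 * Real.pi * Complex.I)⁻¹ * contourIntegral γ fun t => (t - z)⁻¹

/-- The closed path `γ` encircles the point `z` once in the positive direction. -/
def EncirclesOnce {p : ℂ} (γ : Path p p) (z : ℂ) : Prop :=
  z ∉ Set.range γ ∧ windingNumber γ z = 1

/-- The integral `∫_{c-i∞}^{c+i∞} f(s) ds`. -/
def verticalIntegral (c : ℝ) (f : ℂ → ℂ) : ℂ :=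
  Complex.I * ∫ v : ℝ, f (c + v * Complex.I)

/-! ### The integrand -/

/-- The hypergeometric function `₀F₁(-; b | z) = ∑_n z^n / ((b)_n n!)`. -/
def hyp0F1 (b z : ℂ) : ℂ :=
  ∑' n : ℕ, z ^ n / ((ascPochhammer ℂ n).eval b * (n ! : ℂ))

/-- The integrand of the double contour integral. -/
def kernelIntegrand (N ν : ℕ) (μ : ℝ) (k m : ℕ) (x y : ℝ) (t s : ℂ) : ℂ :=
  Complex.Gamma s ^ 2 * Complex.Gamma (s + ν + k) * Complex.Gamma (s - t + m - 1)
      * Complex.Gamma (t - N + 1)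
    / (Complex.Gamma (t + 1) ^ 2 * Complex.Gamma (t + ν + 1) * Complex.Gamma (s - N + m)
      * Complex.Gamma (s - t + k))
    * ((1 - delta μ ^ 2 / alpha μ ^ 2 : ℝ) : ℂ) ^ ν
    * ((alpha μ ^ 2 - delta μ ^ 2 : ℝ) : ℂ) ^ (t + 1)
    * (x : ℂ) ^ t
    * hyp0F1 (t + 1) ((delta μ ^ 2 * x : ℝ) : ℂ)
    * ((alpha μ ^ 2 * y : ℝ) : ℂ) ^ (-s)

/-- `K_N^{(k)}(x,y)`, for the closed contour `γ` in `t` and the line `Re s = c`. -/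
def kernelCoeff (N ν : ℕ) (μ : ℝ) {p : ℂ} (γ : Path p p) (c : ℝ) (k : ℕ) (x y : ℝ) : ℂ :=
  ∑ m ∈ Finset.range (k + 1),
    (-1) ^ m / (2 * Real.pi * Complex.I) ^ 2 * (N.choose m : ℂ) *
      contourIntegral γ fun t =>
        verticalIntegral c fun s => kernelIntegrand N ν μ k m x y t s

end CoupledGaussian

end

noncomputable section

namespace CoupledGaussian

open Polynomial Finset

/-! ### Falling factorials -/

/-- The falling factorial `a (a - 1) ⋯ (a - r + 1)`. -/
def falling (r : ℕ) (a : ℂ) : ℂ := (descPochhammer ℂ r).eval a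

@[simp] theorem falling_zero (a : ℂ) : falling 0 a = 1 := by simp [falling]

theorem falling_eq_prod (r : ℕ) (a : ℂ) : falling r a = ∏ i ∈ range r, (a - i) := by
  simp [falling, descPochhammer_eval_eq_prod_range]

theorem falling_succ (r : ℕ) (a : ℂ) : falling (r + 1) a = falling r a * (a - r) := by
  simp [falling_eq_prod, prod_range_succ]

theorem falling_succ_left (r : ℕ) (a : ℂ) : falling (r + 1) a = a * falling r (a - 1) := by
  rw [falling_eq_prod, falling_eq_prod, prod_range_succ', mul_comm]
  congr 1
  · simp
  · refine prod_congr rfl fun i _ => ?_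
    push_cast; ring

theorem falling_add (r s : ℕ) (a : ℂ) : falling (r + s) a = falling r a * falling s (a - r) := by
  rw [falling_eq_prod, falling_eq_prod, falling_eq_prod, prod_range_add]
  congr 1
  refine prod_congr rfl fun i _ => ?_
  push_cast; ring

theorem falling_succ_add_one (r : ℕ) (a : ℂ) :
    falling (r + 1) (a + 1) = falling (r + 1) a + (r + 1) * falling r a := by
  rw [falling_succ_left, falling_succ, add_sub_cancel_right]
  ring

theorem falling_natCast_of_lt {a r : ℕ} (h : a < r) : falling r a = 0 :=
  descPochhammer_eval_coe_nat_of_lt h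

theorem falling_natCast (a r : ℕ) : falling r a = (a.descFactorial r : ℂ) := by
  rw [falling, descPochhammer_eval_eq_descFactorial]

theorem falling_neg_one (r : ℕ) : falling r (-1) = (-1) ^ r * r ! := by
  induction r with
  | zero => simp
  | succ r ih =>
    rw [falling_succ, ih, Nat.factorial_succ]
    push_cast; ring

theorem falling_mul_falling (a : ℂ) {N n k m : ℕ} (hn : n < N) (hk : k < N) (hm : m ≤ k) :
    falling k (a + k) * falling (N - m) a =
      falling n (a + k) * falling (k - m + 1) (a + k - n) *
        falling (N - 1 - n) (a - n - 1 + m) := by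
  have h1 := falling_add k (N - m) (a + k)
  have h2 := falling_add (n + (k - m + 1)) (N - 1 - n) (a + k)
  rw [falling_add n (k - m + 1)] at h2
  have e1 : n + (k - m + 1) + (N - 1 - n) = k + (N - m) := by omega
  rw [e1, h1] at h2
  rw [add_sub_cancel_right] at h2
  rw [h2]
  congr 2
  push_cast [Nat.cast_sub hm]
  ring

/-! ### Alternating binomial sums -/

theorem sum_alternating_choose_mul_eval {p : ℂ[X]} {N : ℕ} (hp : p.natDegree < N) (x : ℂ) :
    ∑ m ∈ range (N + 1), (-1) ^ m * (N.choose m : ℂ) * p.eval (x + m) = 0 := by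
  have h := congr_fun (Polynomial.fwdDiff_iter_eq_zero_of_degree_lt hp) x
  rw [fwdDiff_iter_eq_sum_shift] at h
  have h2 := congr_arg (fun z => (-1 : ℂ) ^ N * z) h
  simp only [mul_sum, Pi.zero_apply, mul_zero] at h2
  rw [← h2]
  refine sum_congr rfl fun m hm => ?_
  have hm' : m ≤ N := by simpa [Nat.lt_succ_iff] using hm
  have : (-1 : ℂ) ^ N * (-1) ^ (N - m) = (-1) ^ m := by
    obtain ⟨d, rfl⟩ := Nat.exists_eq_add_of_le hm'
    rw [Nat.add_sub_cancel_left, pow_add, mul_assoc, ← mul_pow]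
    simp
  simp only [zsmul_eq_mul, nsmul_eq_mul, mul_one]
  push_cast
  rw [← this]; ring

theorem sum_alternating_choose_mul_eval_sub {p : ℂ[X]} {N : ℕ} (hp : p.natDegree < N) (x : ℂ) :
    ∑ m ∈ range (N + 1), (-1) ^ m * (N.choose m : ℂ) * p.eval (x - m) = 0 := by
  have h := sum_alternating_choose_mul_eval (p := p.comp (-X)) (N := N)
    (by rwa [natDegree_comp, natDegree_neg, natDegree_X, mul_one]) (-x)
  rw [← h]
  refine sum_congr rfl fun m _ => ?_
  simp only [eval_comp, eval_neg, eval_X]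
  congr 2; ring

theorem natDegree_descPochhammer_comp_X_add_C (r : ℕ) (u : ℂ) :
    ((descPochhammer ℂ r).comp (X + C u)).natDegree = r := by
  rw [natDegree_comp, descPochhammer_natDegree, natDegree_X_add_C, mul_one]

theorem sum_alternating_choose_mul_falling {r N : ℕ} (hr : r < N) (x : ℂ) :
    ∑ m ∈ range (N + 1), (-1) ^ m * (N.choose m : ℂ) * falling r (x + m) = 0 :=
  sum_alternating_choose_mul_eval (by rwa [descPochhammer_natDegree]) x

theorem sum_alternating_choose_mul_falling_sub {r N : ℕ} (hr : r < N) (x : ℂ) :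
    ∑ m ∈ range (N + 1), (-1) ^ m * (N.choose m : ℂ) * falling r (x - m) = 0 :=
  sum_alternating_choose_mul_eval_sub (by rwa [descPochhammer_natDegree]) x

/-- The bilinear concomitant of the falling factorials `x^{\underline j}` and
`(x - u)^{\underline r}` for the `N`-th difference operator. -/
def concomitant (N j r : ℕ) (u M : ℂ) : ℂ :=
  ∑ k ∈ range N, ∑ m ∈ range (k + 1),
    (-1) ^ m * (N.choose m : ℂ) * falling j (M - k) * falling r (M - k + m - u)

theorem concomitant_add_one {N j r : ℕ} (hj : j < N) (hr : r < N) (u M : ℂ) :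
    concomitant N j r u (M + 1) = concomitant N j r u M := by
  set c : ℕ → ℂ := fun m => (-1) ^ m * (N.choose m : ℂ) with hc
  set W : ℕ → ℂ := fun k => ∑ m ∈ range (k + 1),
    c m * falling j (M + 1 - k) * falling r (M + 1 - k + m - u) with hW
  have h1 : concomitant N j r u (M + 1) = ∑ k ∈ range N, W k := rfl
  have h2 : concomitant N j r u M =
      ∑ k ∈ range N, (W (k + 1) - c (k + 1) * falling j (M + 1 - (k + 1 : ℕ)) *
        falling r (M + 1 - u)) := by
    refine sum_congr rfl fun k _ => ?_
    simp only [hW]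
    rw [sum_range_succ _ (k + 1)]
    rw [show M + 1 - ((k + 1 : ℕ) : ℂ) + ((k + 1 : ℕ) : ℂ) - u = M + 1 - u by ring,
      add_sub_cancel_right]
    refine sum_congr rfl fun m _ => ?_
    rw [show M + 1 - ((k + 1 : ℕ) : ℂ) = M - k by push_cast; ring]
  have h3 : W N = 0 := by
    have := sum_alternating_choose_mul_falling hr (M + 1 - N - u)
    simp only [hW]
    rw [← mul_zero (falling j (M + 1 - N)), ← this, mul_sum]
    refine sum_congr rfl fun m _ => ?_
    rw [show M + 1 - (N : ℂ) + m - u = M + 1 - N - u + m by ring]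
    ring
  have h4 : W 0 + (∑ k ∈ range N, c (k + 1) * falling j (M + 1 - (k + 1 : ℕ)) *
        falling r (M + 1 - u)) = 0 := by
    have := sum_alternating_choose_mul_falling_sub hj (M + 1)
    rw [sum_range_succ', Nat.cast_zero, sub_zero] at this
    rw [← sum_mul]
    simp only [hW, zero_add, sum_range_one, Nat.cast_zero, sub_zero, add_zero]
    linear_combination this * falling r (M + 1 - u)
  have h5 := sum_range_sub W N
  rw [sum_sub_distrib] at h5 h2
  rw [h1, h2]
  linear_combination h4 - h5 - h3

theorem concomitant_shift {N j r : ℕ} (hj : j + 1 < N) (hr : r + 1 < N) (u M : ℂ) :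
    (j + 1) * concomitant N j (r + 1) (u - 1) M + (r + 1) * concomitant N (j + 1) r u M = 0 := by
  rw [← sub_eq_zero.2 (concomitant_add_one hj hr u M)]
  simp only [concomitant, mul_sum, ← sum_add_distrib, ← sum_sub_distrib]
  refine sum_congr rfl fun k _ => sum_congr rfl fun m _ => ?_
  rw [show M + 1 - (k : ℂ) = M - k + 1 by ring, falling_succ_add_one,
    show M - (k : ℂ) + 1 + m - u = (M - k + m - u) + 1 by ring,
    show M - (k : ℂ) + m - (u - 1) = (M - k + m - u) + 1 by ring, falling_succ_add_one]
  ring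

theorem concomitant_shift_zero {N j : ℕ} (hj : j + 1 < N) (u M : ℂ) :
    concomitant N j 0 u M = 0 := by
  have h : (j + 1 : ℂ) * concomitant N j 0 u M = 0 := by
    rw [← sub_eq_zero.2 (concomitant_add_one hj (by omega : 0 < N) u M)]
    simp only [concomitant, mul_sum, ← sum_sub_distrib]
    refine sum_congr rfl fun k _ => sum_congr rfl fun m _ => ?_
    rw [show M + 1 - (k : ℂ) = M - k + 1 by ring, falling_succ_add_one]
    simp only [falling_zero]
    ring
  exact (mul_eq_zero.1 h).resolve_left (Nat.cast_add_one_ne_zero j)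

theorem concomitant_eq_zero {N r : ℕ} :
    ∀ {j : ℕ}, j + r + 1 < N → ∀ u M : ℂ, concomitant N j r u M = 0 := by
  induction r with
  | zero => exact fun h u M => concomitant_shift_zero (by omega) u M
  | succ r ih =>
    intro j h u M
    have h1 := concomitant_shift (N := N) (j := j) (r := r) (by omega) (by omega) (u + 1) M
    rw [ih (by omega), mul_zero, add_zero, add_sub_cancel_right] at h1
    exact (mul_eq_zero.1 h1).resolve_left (Nat.cast_add_one_ne_zero j)

theorem concomitant_natCast {N j r : ℕ} (hj : j < N) (hr : r < N) (u : ℂ) (M : ℕ) :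
    concomitant N j r u M = concomitant N j r u 0 := by
  induction M with
  | zero => simp
  | succ M ih => rw [Nat.cast_succ, concomitant_add_one hj hr, ih]

theorem concomitant_falling {N n j : ℕ} (hn : n < N) (hj : j < N) (M : ℕ) :
    concomitant N j (N - 1 - n) (n + 1) M =
      if j = n then (-1) ^ (N - 1 - n) * (n ! * (N - 1 - n)! : ℂ) else 0 := by
  rcases lt_or_ge j n with h | h
  · rw [if_neg h.ne, concomitant_eq_zero (by omega)]
  have hr : N - 1 - n < N := by omega
  rw [concomitant_natCast hj hr, ← concomitant_natCast hj hr _ (N - 1), concomitant]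
  have key : ∀ k ∈ range N, ∀ m ∈ range (k + 1), ¬ (k = N - 1 - n ∧ m = 0 ∧ j = n) →
      (-1) ^ m * (N.choose m : ℂ) * falling j (((N - 1 : ℕ) : ℂ) - k) *
        falling (N - 1 - n) (((N - 1 : ℕ) : ℂ) - k + m - (n + 1)) = 0 := by
    intro k hk m hm hne
    rw [mem_range] at hk hm
    by_cases h1 : N - 1 - k < j
    · have : falling j (((N - 1 : ℕ) : ℂ) - k) = 0 := by
        rw [← Nat.cast_sub (by omega)]
        exact falling_natCast_of_lt h1
      rw [this]; ring
    · have : falling (N - 1 - n) (((N - 1 : ℕ) : ℂ) - k + m - (n + 1)) = 0 := by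
        rw [show ((N - 1 : ℕ) : ℂ) - k + m - (n + 1) = ((N - 1 - k + m - (n + 1) : ℕ) : ℂ) by
          have e := congr_arg (Nat.cast : ℕ → ℂ)
            (by omega : N - 1 - k + m - (n + 1) + (n + 1) + k = N - 1 + m)
          simp only [Nat.cast_add, Nat.cast_one] at e
          linear_combination -e]
        exact falling_natCast_of_lt (by omega)
      rw [this]; ring
  split_ifs with hjn
  · subst hjn
    rw [sum_eq_single_of_mem (N - 1 - j) (by simp; omega)]
    · rw [sum_eq_single_of_mem 0 (by simp)]
      · have e : (((N - 1 : ℕ) : ℂ) - ((N - 1 - j : ℕ) : ℂ)) = j := by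
          rw [← Nat.cast_sub (by omega)]; congr 1; omega
        rw [e, falling_natCast, Nat.descFactorial_self]
        simp only [pow_zero, Nat.choose_zero_right, Nat.cast_one, Nat.cast_zero, add_zero]
        rw [show (j : ℂ) - (j + 1) = -1 by ring, falling_neg_one]
        ring
      · intro m hm hm0
        exact key _ (by simp; omega) m hm (by tauto)
    · intro k hk hk'
      exact sum_eq_zero fun m hm => key k hk m hm (by tauto)
  · exact sum_eq_zero fun k hk => sum_eq_zero fun m hm => key k hk m hm (by tauto)

/-! ### The polynomials that arise from the residues -/

/-- `∑_{m ≤ k} (-1)^m C(N, m) (a - n - 1 + m)^{\underline{N - 1 - n}}` as a polynomial in `a`. -/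
def partialSumPoly (N n k : ℕ) : ℂ[X] :=
  ∑ m ∈ range (k + 1), C ((-1) ^ m * (N.choose m : ℂ)) *
    (descPochhammer ℂ (N - 1 - n)).comp (X + C ((m : ℂ) - n - 1))

theorem eval_partialSumPoly (N n k : ℕ) (a : ℂ) :
    (partialSumPoly N n k).eval a = ∑ m ∈ range (k + 1),
      (-1) ^ m * (N.choose m : ℂ) * falling (N - 1 - n) (a - n - 1 + m) := by
  simp only [partialSumPoly, eval_finsetSum, eval_mul, eval_C, eval_comp, eval_add, eval_X, falling]
  refine sum_congr rfl fun m _ => ?_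
  congr 2; ring

theorem eval_partialSumPoly_neg {N n k b : ℕ} (hn : n < N) (hk : k < N) (hb : 1 ≤ b)
    (hbk : b + n ≤ k) : (partialSumPoly N n k).eval (-(b : ℂ)) = 0 := by
  have h := sum_alternating_choose_mul_falling (r := N - 1 - n) (N := N) (by omega)
    (-(b : ℂ) - n - 1)
  rw [eval_partialSumPoly, ← h]
  refine sum_subset (range_subset_range.2 (by omega)) fun m hm hm' => ?_
  rw [mem_range] at hm hm'
  rw [show -(b : ℂ) - n - 1 + m = ((m - (b + n + 1) : ℕ) : ℂ) by
    rw [Nat.cast_sub (by omega)]; push_cast; ring, falling_natCast_of_lt (by omega), mul_zero]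

theorem exists_residuePoly {N n k : ℕ} (hn : n < N) (hk : k < N) :
    ∃ R : ℂ[X], R.degree < ((N - k : ℕ) : WithBot ℕ) ∧ ∀ a : ℂ,
      R.eval a * falling k (a + k) = falling n (a + k) * (partialSumPoly N n k).eval a := by
  set P : ℂ[X] := (descPochhammer ℂ n).comp (X + C (k : ℂ)) * partialSumPoly N n k with hP
  set Q : ℂ[X] := ∏ i ∈ range k, (X - C (-((i + 1 : ℕ) : ℂ))) with hQ
  have hPe : ∀ a, P.eval a = falling n (a + k) * (partialSumPoly N n k).eval a := fun a => by
    simp [hP, falling]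
  have hQe : ∀ a, Q.eval a = falling k (a + k) := fun a => by
    rw [hQ, eval_prod, falling_eq_prod, ← prod_range_reflect]
    refine prod_congr rfl fun i hi => ?_
    rw [mem_range] at hi
    have : k - 1 - i + 1 + i = k := by omega
    simp only [eval_sub, eval_X, eval_C]
    rw [← this]; push_cast
    have : k - 1 - i + 1 + i = k := by omega
    simp
    ring_nf
  have hdvd : Q ∣ P := by
    refine Finset.prod_dvd_of_coprime (fun i _ j _ hij => ?_) fun i hi => ?_
    · refine (pairwise_coprime_X_sub_C (s := fun i : ℕ => -((i + 1 : ℕ) : ℂ)) ?_) hij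
      intro a b hab
      simpa using hab
    · rw [mem_range] at hi
      rw [dvd_iff_isRoot, IsRoot.def, hPe]
      by_cases h : k - (i + 1) < n
      · rw [show -((i + 1 : ℕ) : ℂ) + k = ((k - (i + 1) : ℕ) : ℂ) by
          rw [Nat.cast_sub (by omega)]; ring, falling_natCast_of_lt h, zero_mul]
      · rw [eval_partialSumPoly_neg hn hk (by omega) (by omega), mul_zero]
  obtain ⟨R, hR⟩ := hdvd
  refine ⟨R, ?_, fun a => by rw [← hQe, ← hPe, hR, eval_mul, mul_comm]⟩
  by_cases hR0 : R = 0
  · rw [hR0, degree_zero]; exact WithBot.bot_lt_coe _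
  rw [degree_eq_natDegree hR0]
  have hQm : Q.Monic := monic_prod_of_monic _ _ fun i _ => monic_X_sub_C _
  have hQd : Q.natDegree = k := by
    rw [hQ, natDegree_prod_of_monic _ _ fun i _ => monic_X_sub_C _]
    simp only [natDegree_X_sub_C, sum_const, card_range, smul_eq_mul, mul_one]
  have hV : (partialSumPoly N n k).natDegree ≤ N - 1 - n := by
    refine natDegree_sum_le_of_forall_le _ _ fun m _ => ?_
    exact (natDegree_C_mul_le _ _).trans (natDegree_descPochhammer_comp_X_add_C _ _).le
  have hPd : P.natDegree ≤ n + (N - 1 - n) :=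
    natDegree_mul_le.trans (add_le_add (natDegree_descPochhammer_comp_X_add_C _ _).le hV)
  rw [hR, hQm.natDegree_mul' hR0, hQd] at hPd
  exact_mod_cast (by omega : R.natDegree < N - k)

/-- A polynomial `R` of degree less than `N - k` with
`∑_{m ≤ k} (-1)^m C(N, m) a^{\underline{N - m}} / ∏_{m ≤ j ≤ k} (a - n + j) = R(a)`. -/
def residuePoly (N n k : ℕ) : ℂ[X] :=
  if h : n < N ∧ k < N then (exists_residuePoly h.1 h.2).choose else 0

theorem degree_residuePoly {N n k : ℕ} (hn : n < N) (hk : k < N) :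
    (residuePoly N n k).degree < ((N - k : ℕ) : WithBot ℕ) := by
  rw [residuePoly, dif_pos ⟨hn, hk⟩]
  exact (exists_residuePoly hn hk).choose_spec.1

theorem eval_residuePoly_mul {N n k : ℕ} (hn : n < N) (hk : k < N) (a : ℂ) :
    (residuePoly N n k).eval a * falling k (a + k) =
      falling n (a + k) * (partialSumPoly N n k).eval a := by
  rw [residuePoly, dif_pos ⟨hn, hk⟩]
  exact (exists_residuePoly hn hk).choose_spec.2 a

theorem eval_residuePoly {N n k : ℕ} (hn : n < N) (hk : k < N) {a : ℂ} (ha : -1 < a.re)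
    (hne : ∀ j ≤ k, a - n + j ≠ 0) :
    (residuePoly N n k).eval a = ∑ m ∈ range (k + 1), (-1) ^ m * (N.choose m : ℂ) *
      (falling (N - m) a * (falling (k - m + 1) (a + k - n))⁻¹) := by
  have h0 : falling k (a + k) ≠ 0 := by
    rw [falling_eq_prod, prod_ne_zero_iff]
    intro i hi h
    rw [mem_range] at hi
    have h1 := congr_arg Complex.re h
    have h2 : ((i + 1 : ℕ) : ℝ) ≤ k := by exact_mod_cast hi
    simp at h1 h2
    linarith
  refine mul_right_cancel₀ h0 ?_
  rw [eval_residuePoly_mul hn hk, eval_partialSumPoly, mul_sum, sum_mul]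
  refine sum_congr rfl fun m hm => ?_
  have hm' : m ≤ k := by simpa [Nat.lt_succ_iff] using hm
  have h1 : falling (k - m + 1) (a + k - n) ≠ 0 := by
    rw [falling_eq_prod, prod_ne_zero_iff]
    intro i hi h
    rw [mem_range] at hi
    refine hne (k - i) (by omega) ?_
    rw [← h, Nat.cast_sub (by omega)]; ring
  have h2 := falling_mul_falling a hn hk hm'
  field_simp
  linear_combination -h2 * (N.choose m : ℂ)

theorem sum_falling_mul_residuePoly {N n j : ℕ} (hn : n < N) (hj : j < N) (M : ℕ) :
    ∑ k ∈ range N, falling (k + j) M * (residuePoly N n k).eval ((M : ℂ) - k) =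
      if j = n then (-1) ^ (N - 1 - n) * (n ! * (N - 1 - n)! : ℂ) * falling n M else 0 := by
  have h := concomitant_falling hn hj M
  have : ∑ k ∈ range N, falling (k + j) M * (residuePoly N n k).eval ((M : ℂ) - k) =
      concomitant N j (N - 1 - n) (n + 1) M * falling n M := by
    rw [concomitant, sum_mul]
    refine sum_congr rfl fun k hk => ?_
    have h1 := eval_residuePoly_mul hn (mem_range.1 hk) ((M : ℂ) - k)
    rw [sub_add_cancel, eval_partialSumPoly] at h1
    have h2 : falling (k + j) M * (residuePoly N n k).eval ((M : ℂ) - k) =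
        falling j ((M : ℂ) - k) * ((residuePoly N n k).eval ((M : ℂ) - k) * falling k M) := by
      rw [falling_add]; ring
    rw [h2, h1, mul_sum, mul_sum, sum_mul]
    refine sum_congr rfl fun m _ => ?_
    rw [show (M : ℂ) - k - n - 1 + m = M - k + m - (n + 1) by ring]
    ring
  rw [this, h]
  split_ifs <;> simp

theorem exists_eq_sum_of_degree_lt {N : ℕ} {b : ℕ → ℂ[X]} (hb : ∀ i, (b i).Monic)
    (hd : ∀ i, (b i).natDegree = i) {p : ℂ[X]} (hp : p.degree < (N : WithBot ℕ)) :
    ∃ d : ℕ → ℂ, p = ∑ l ∈ range N, C (d l) * b l := by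
  induction N generalizing p with
  | zero =>
    refine ⟨0, ?_⟩
    rw [range_zero, sum_empty]
    exact degree_eq_bot.1 (Nat.WithBot.lt_zero_iff.1 (by simpa using hp))
  | succ N ih =>
    have hlt : (p - C (p.coeff N) * b N).degree < (N : WithBot ℕ) := by
      rw [degree_lt_iff_coeff_zero]
      intro m hm
      rw [coeff_sub, coeff_C_mul]
      rcases hm.eq_or_lt with rfl | hm
      · have := hb N
        rw [Monic, leadingCoeff, hd] at this
        rw [this]; ring
      · rw [coeff_eq_zero_of_degree_lt (hp.trans_le (by exact_mod_cast hm)),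
          coeff_eq_zero_of_natDegree_lt (p := b N) (by rwa [hd])]
        ring
    obtain ⟨d, hd'⟩ := ih hlt
    refine ⟨Function.update d N (p.coeff N), ?_⟩
    rw [sum_range_succ, Function.update_self, ← sub_eq_iff_eq_add, hd']
    refine sum_congr rfl fun l hl => ?_
    rw [Function.update_of_ne (mem_range.1 hl).ne]

end CoupledGaussian

end

noncomputable section

namespace CoupledGaussian

open MeasureTheory Set Filter Topology

/-! ### Contour integrals along piecewise `C¹` paths -/

theorem curveIntegralFun_oneForm {p q : ℂ} (γ : Path p q) (f : ℂ → ℂ) (t : ℝ) :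
    curveIntegralFun (oneForm f) γ t = derivWithin γ.extend (Icc 0 1) t * f (γ.extend t) := by
  rw [curveIntegralFun_def, oneForm, ContinuousLinearMap.toSpanSingleton_apply, smul_eq_mul]

theorem IsPiecewiseC1.intervalIntegrable_derivWithin {p q : ℂ} {γ : Path p q}
    (hγ : IsPiecewiseC1 γ) :
    IntervalIntegrable (fun t => derivWithin γ.extend (Icc 0 1) t) volume 0 1 := by
  obtain ⟨n, τ, hτ, h0, h1, hd⟩ := hγ
  rw [← h0, ← h1]
  refine IntervalIntegrable.trans_iterate fun k hk => ?_
  rcases (hτ (Nat.le_add_right k 1)).eq_or_lt with h | h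
  · rw [h]
  have hc := (hd k hk).continuousOn_derivWithin (uniqueDiffOn_Icc h) le_rfl
  have hi : IntervalIntegrable (derivWithin γ.extend (Icc (τ k) (τ (k + 1)))) volume
      (τ k) (τ (k + 1)) := by
    apply ContinuousOn.intervalIntegrable
    rwa [uIcc_of_le h.le]
  refine hi.congr_uIoo fun t ht => ?_
  rw [uIoo_of_le h.le] at ht
  rw [derivWithin_of_mem_nhds (Icc_mem_nhds ht.1 ht.2), h0, h1, derivWithin_of_mem_nhds]
  refine Icc_mem_nhds ?_ ?_
  · rw [← h0]; exact (hτ (Nat.zero_le k)).trans_lt ht.1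
  · rw [← h1]; exact ht.2.trans_le (hτ hk)

theorem IsPiecewiseC1.hasDerivAt_off_countable {p q : ℂ} {γ : Path p q} (hγ : IsPiecewiseC1 γ) :
    ∃ s : Set ℝ, s.Countable ∧ ∀ t ∈ Ioo (0 : ℝ) 1 \ s,
      HasDerivAt γ.extend (derivWithin γ.extend (Icc 0 1) t) t := by
  obtain ⟨n, τ, hτ, h0, h1, hd⟩ := hγ
  refine ⟨range τ, countable_range τ, fun t ht => ?_⟩
  have hex : ∃ k, t < τ k := ⟨n, by rw [h1]; exact ht.1.2⟩
  classical
  have hk := Nat.find_spec hex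
  have hk0 : Nat.find hex ≠ 0 := by
    intro h
    rw [h, h0] at hk
    exact absurd hk (not_lt.2 ht.1.1.le)
  obtain ⟨k, hk'⟩ := Nat.exists_eq_succ_of_ne_zero hk0
  have hlt : τ k < t := by
    refine lt_of_le_of_ne (not_lt.1 (Nat.find_min hex (by omega : k < Nat.find hex))) ?_
    intro h
    exact ht.2 ⟨k, h⟩
  rw [hk'] at hk
  have hkn : k < n := by
    by_contra h
    have := hτ (not_lt.1 h)
    rw [h1] at this
    linarith [ht.1.2]
  have hda : DifferentiableAt ℝ γ.extend t :=
    ((hd k hkn).differentiableOn one_ne_zero t ⟨hlt.le, hk.le⟩).differentiableAt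
      (Icc_mem_nhds hlt hk)
  rw [derivWithin_of_mem_nhds (Icc_mem_nhds ht.1.1 ht.1.2)]
  exact hda.hasDerivAt

theorem IsPiecewiseC1.curveIntegrable {p q : ℂ} {γ : Path p q} (hγ : IsPiecewiseC1 γ)
    {f : ℂ → ℂ} (hf : ContinuousOn f (range γ)) : CurveIntegrable (oneForm f) γ := by
  have h : IntervalIntegrable
      (fun t => derivWithin γ.extend (Icc 0 1) t * f (γ.extend t)) volume 0 1 := by
    refine hγ.intervalIntegrable_derivWithin.mul_continuousOn ?_
    refine hf.comp γ.continuous_extend.continuousOn fun t _ => ?_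
    rw [← γ.extend_range]
    exact mem_range_self t
  rw [CurveIntegrable]
  convert h using 1
  exact funext fun t => curveIntegralFun_oneForm γ f t

theorem countable_setOf_eq_and_deriv_ne_zero (f : ℝ → ℂ) (z : ℂ) :
    {t | f t = z ∧ deriv f t ≠ 0}.Countable := by
  set S := {t | f t = z ∧ deriv f t ≠ 0}
  have : DiscreteTopology S := by
    rw [discreteTopology_subtype_iff]
    rintro x ⟨hx, hx'⟩
    have h := (differentiableAt_of_deriv_ne_zero hx').hasDerivAt.eventually_ne hx' (c := z)
    rw [← disjoint_iff, disjoint_principal_right]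
    filter_upwards [h] with y hy hyS
    exact hy hyS.1
  exact countable_of_Lindelof_of_discrete (X := S)

theorem curveIntegralFun_congr_ae {p q : ℂ} (γ : Path p q) {f g : ℂ → ℂ} {Z : Set ℂ}
    (hZ : Z.Countable) (h : ∀ z ∈ range γ, z ∉ Z → f z = g z) :
    curveIntegralFun (oneForm f) γ =ᵐ[volume.restrict (uIoc 0 1)]
      curveIntegralFun (oneForm g) γ := by
  have hS : (⋃ z ∈ Z, {t | γ.extend t = z ∧ deriv γ.extend t ≠ 0}).Countable :=
    hZ.biUnion fun z _ => countable_setOf_eq_and_deriv_ne_zero _ z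
  rw [uIoc_of_le zero_le_one, ← restrict_Ioo_eq_restrict_Ioc]
  filter_upwards [ae_restrict_mem measurableSet_Ioo, hS.ae_notMem _] with t ht htS
  rw [curveIntegralFun_oneForm, curveIntegralFun_oneForm,
    derivWithin_of_mem_nhds (Icc_mem_nhds ht.1 ht.2)]
  by_cases hz : γ.extend t ∈ Z
  · have : deriv γ.extend t = 0 := by
      by_contra hd
      exact htS (mem_biUnion hz ⟨rfl, hd⟩)
    rw [this, zero_mul, zero_mul]
  · rw [h _ (by rw [← γ.extend_range]; exact mem_range_self t) hz]

theorem curveIntegrable_congr {p q : ℂ} {γ : Path p q} {f g : ℂ → ℂ} {Z : Set ℂ}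
    (hZ : Z.Countable) (h : ∀ z ∈ range γ, z ∉ Z → f z = g z)
    (hg : CurveIntegrable (oneForm g) γ) : CurveIntegrable (oneForm f) γ :=
  IntervalIntegrable.congr_ae hg (curveIntegralFun_congr_ae γ hZ h).symm

theorem contourIntegral_congr {p q : ℂ} {γ : Path p q} {f g : ℂ → ℂ} {Z : Set ℂ}
    (hZ : Z.Countable) (h : ∀ z ∈ range γ, z ∉ Z → f z = g z) :
    contourIntegral γ f = contourIntegral γ g := by
  rw [contourIntegral, contourIntegral, curveIntegral_def, curveIntegral_def]
  exact intervalIntegral.integral_congr_ae_restrict (curveIntegralFun_congr_ae γ hZ h)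

theorem contourIntegral_add {p q : ℂ} {γ : Path p q} {f g : ℂ → ℂ}
    (hf : CurveIntegrable (oneForm f) γ) (hg : CurveIntegrable (oneForm g) γ) :
    contourIntegral γ (fun t => f t + g t) = contourIntegral γ f + contourIntegral γ g := by
  rw [contourIntegral, contourIntegral, contourIntegral, ← curveIntegral_add hf hg]
  congr 1
  ext t
  simp [oneForm]

theorem contourIntegral_const_mul {p q : ℂ} {γ : Path p q} (a : ℂ) (f : ℂ → ℂ) :
    contourIntegral γ (fun t => a * f t) = a * contourIntegral γ f := by
  rw [contourIntegral, contourIntegral, ← smul_eq_mul a (curveIntegral _ _), ← curveIntegral_smul]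
  congr 1
  ext t
  simp [oneForm]

theorem contourIntegral_finset_sum {p q : ℂ} {γ : Path p q} {ι : Type*} (s : Finset ι)
    {f : ι → ℂ → ℂ} (hf : ∀ i ∈ s, CurveIntegrable (oneForm (f i)) γ) :
    contourIntegral γ (fun t => ∑ i ∈ s, f i t) = ∑ i ∈ s, contourIntegral γ (f i) := by
  simp only [contourIntegral, curveIntegral_def]
  rw [← intervalIntegral.integral_finsetSum hf]
  congr 1
  ext t
  simp only [curveIntegralFun_oneForm, Finset.mul_sum]

theorem contourIntegral_eq_zero {p : ℂ} {γ : Path p p} (hγ : IsPiecewiseC1 γ) {U : Set ℂ}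
    (hU : Convex ℝ U) (hUo : IsOpen U) (hγU : range γ ⊆ U) {f : ℂ → ℂ}
    (hf : DifferentiableOn ℂ f U) : contourIntegral γ f = 0 := by
  obtain ⟨g, hg⟩ := hU.exists_forall_hasDerivWithinAt hf
  obtain ⟨s, hs, hd⟩ := hγ.hasDerivAt_off_countable
  have hmem : ∀ t, γ.extend t ∈ U := fun t =>
    hγU (by rw [← γ.extend_range]; exact mem_range_self t)
  have hgd : ∀ t, HasDerivAt g (f (γ.extend t)) (γ.extend t) := fun t =>
    (hg _ (hmem t)).hasDerivAt (hUo.mem_nhds (hmem t))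
  rw [contourIntegral, curveIntegral_def]
  have h := integral_eq_of_hasDerivAt_off_countable (g ∘ γ.extend)
    (curveIntegralFun (oneForm f) γ) hs (a := 0) (b := 1) ?_ ?_
    (hγ.curveIntegrable (hf.continuousOn.mono hγU))
  · rw [h]; simp
  · exact fun t _ => ((hgd t).continuousAt.comp γ.continuous_extend.continuousAt).continuousWithinAt
  · intro t ht
    rw [min_eq_left zero_le_one, max_eq_right zero_le_one] at ht
    rw [curveIntegralFun_oneForm, mul_comm]
    exact (hgd t).comp_of_eq t (hd t ht) rfl

theorem EncirclesOnce.mem_of_convex {p : ℂ} {γ : Path p p} (hγ : IsPiecewiseC1 γ) {U : Set ℂ}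
    (hU : Convex ℝ U) (hUo : IsOpen U) (hγU : range γ ⊆ U) {z : ℂ} (hz : EncirclesOnce γ z) :
    z ∈ U := by
  by_contra h
  have h0 := hz.2
  rw [windingNumber, contourIntegral_eq_zero hγ hU hUo hγU, mul_zero] at h0
  · exact zero_ne_one h0
  · intro t ht
    refine DifferentiableAt.differentiableWithinAt ?_
    refine (differentiableAt_id.sub_const z).inv (sub_ne_zero.2 ?_)
    rintro rfl
    exact h ht

theorem EncirclesOnce.contourIntegral_inv {p : ℂ} {γ : Path p p} {z : ℂ}
    (hz : EncirclesOnce γ z) :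
    contourIntegral γ (fun t => (t - z)⁻¹) = 2 * Real.pi * Complex.I := by
  have h := hz.2
  rw [windingNumber, inv_mul_eq_iff_eq_mul₀ Complex.two_pi_I_ne_zero, mul_one] at h
  exact h

theorem prod_range_erase_sub {N n : ℕ} (hn : n < N) :
    ∏ j ∈ (Finset.range N).erase n, ((n : ℂ) - j) =
      (-1) ^ (N - 1 - n) * (n ! * (N - 1 - n)! : ℂ) := by
  have h1 : ∏ j ∈ (Finset.range N).erase n, ((n : ℂ) - j) =
      ∏ j ∈ Finset.range N, if j = n then (1 : ℂ) else (n : ℂ) - j := by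
    rw [← Finset.mul_prod_erase (Finset.range N) _ (Finset.mem_range.2 hn), if_pos rfl, one_mul]
    exact Finset.prod_congr rfl fun j hj => by rw [if_neg (Finset.ne_of_mem_erase hj)]
  have h2 : N = n + 1 + (N - 1 - n) := by omega
  rw [h1]
  conv_lhs => rw [h2]
  rw [Finset.prod_range_add, Finset.prod_range_succ, if_pos rfl, mul_one]
  have h3 : (∏ j ∈ Finset.range n, if j = n then (1 : ℂ) else (n : ℂ) - j) = n ! := by
    rw [← Nat.descFactorial_self, ← falling_natCast, falling_eq_prod]
    exact Finset.prod_congr rfl fun j hj => by rw [if_neg (Finset.mem_range.1 hj).ne]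
  rw [h3, mul_left_comm, ← falling_neg_one, falling_eq_prod]
  congr 1
  refine Finset.prod_congr rfl fun j _ => ?_
  rw [if_neg (by omega)]
  push_cast; ring

theorem inv_prod_sub_eq_sum {N : ℕ} (hN : 0 < N) {t : ℂ} (ht : ∀ n < N, t ≠ (n : ℂ)) :
    (∏ j ∈ Finset.range N, (t - j))⁻¹ = ∑ n ∈ Finset.range N,
      (∏ j ∈ (Finset.range N).erase n, ((n : ℂ) - j))⁻¹ * (t - n)⁻¹ := by
  have hinj : Set.InjOn (fun n : ℕ => (n : ℂ)) (Finset.range N) := Nat.cast_injective.injOn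
  have h := congr_arg (Polynomial.eval t)
    (Lagrange.sum_basis hinj ⟨0, Finset.mem_range.2 hN⟩)
  rw [Polynomial.eval_finsetSum, Polynomial.eval_one] at h
  refine inv_eq_of_mul_eq_one_right ?_
  rw [Finset.mul_sum, ← h]
  refine Finset.sum_congr rfl fun n hn => ?_
  rw [Lagrange.eval_basis_not_at_node hn (ht n (Finset.mem_range.1 hn)), Lagrange.eval_nodal,
    Lagrange.nodalWeight, Finset.prod_inv_distrib]

theorem contourIntegral_mul_inv_prod {p : ℂ} {γ : Path p p} (hγ : IsPiecewiseC1 γ) {U : Set ℂ}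
    (hU : Convex ℝ U) (hUo : IsOpen U) (hγU : range γ ⊆ U) {N : ℕ} (hN : 0 < N)
    (hγN : ∀ n < N, EncirclesOnce γ (n : ℂ)) {F : ℂ → ℂ} (hF : DifferentiableOn ℂ F U) :
    contourIntegral γ (fun t => F t * (∏ j ∈ Finset.range N, (t - j))⁻¹) =
      2 * Real.pi * Complex.I * ∑ n ∈ Finset.range N,
        F n * ((-1) ^ (N - 1 - n) * (n ! * (N - 1 - n)! : ℂ))⁻¹ := by
  have hne : ∀ n < N, ∀ t ∈ range γ, t ≠ (n : ℂ) := by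
    rintro n hn t ht rfl
    exact (hγN n hn).1 ht
  set w : ℕ → ℂ := fun n => (∏ j ∈ (Finset.range N).erase n, ((n : ℂ) - j))⁻¹ with hw
  have hnU : ∀ n < N, (n : ℂ) ∈ U := fun n hn => (hγN n hn).mem_of_convex hγ hU hUo hγU
  have hG : ∀ n < N, DifferentiableOn ℂ (dslope F n) U := fun n hn =>
    (Complex.differentiableOn_dslope (hUo.mem_nhds (hnU n hn))).2 hF
  have hc1 : ∀ n < N, CurveIntegrable (oneForm fun t => w n * dslope F n t) γ := fun n hn =>
    hγ.curveIntegrable (continuousOn_const.mul ((hG n hn).continuousOn.mono hγU))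
  have hc2 : ∀ n < N, CurveIntegrable (oneForm fun t => (w n * F n) * (t - (n : ℂ))⁻¹) γ := by
    intro n hn
    refine hγ.curveIntegrable (continuousOn_const.mul ?_)
    exact (continuousOn_id.sub continuousOn_const).inv₀ fun t ht => sub_ne_zero.2 (hne n hn t ht)
  have hc3 : ∀ n < N, CurveIntegrable
      (oneForm fun t => w n * dslope F n t + (w n * F n) * (t - (n : ℂ))⁻¹) γ := by
    intro n hn
    refine hγ.curveIntegrable (ContinuousOn.add ?_ ?_)
    · exact continuousOn_const.mul ((hG n hn).continuousOn.mono hγU)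
    refine continuousOn_const.mul ?_
    exact (continuousOn_id.sub continuousOn_const).inv₀ fun t ht => sub_ne_zero.2 (hne n hn t ht)
  have h1 : contourIntegral γ (fun t => F t * (∏ j ∈ Finset.range N, (t - j))⁻¹) =
      contourIntegral γ (fun t => ∑ n ∈ Finset.range N,
        (w n * dslope F n t + (w n * F n) * (t - (n : ℂ))⁻¹)) := by
    refine contourIntegral_congr (Z := ∅) countable_empty fun t ht _ => ?_
    rw [inv_prod_sub_eq_sum hN fun n hn => hne n hn t ht, Finset.mul_sum]
    refine Finset.sum_congr rfl fun n hn => ?_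
    have hn' := hne n (Finset.mem_range.1 hn) t ht
    rw [dslope_of_ne _ hn', slope_def_field]
    have := sub_ne_zero.2 hn'
    simp only [hw]
    field_simp
    ring
  rw [h1, contourIntegral_finset_sum _ fun n hn => hc3 n (Finset.mem_range.1 hn), Finset.mul_sum]
  refine Finset.sum_congr rfl fun n hn => ?_
  rw [Finset.mem_range] at hn
  rw [contourIntegral_add (hc1 n hn) (hc2 n hn), contourIntegral_const_mul,
    contourIntegral_const_mul, contourIntegral_eq_zero hγ hU hUo hγU (hG n hn),
    (hγN n hn).contourIntegral_inv, ← prod_range_erase_sub hn]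
  ring

/-! ### The region cut out by finitely many vertical lines -/

/-- The points on the same side as `p` of each of the lines `Re t = c + j - 1`, `j < N`. -/
def sameSide (N : ℕ) (c : ℝ) (p : ℂ) : Set ℂ :=
  ⋂ j ∈ Finset.range N, {z | 0 < (p.re - (c + j - 1)) * (z.re - (c + j - 1))}

theorem isOpen_sameSide (N : ℕ) (c : ℝ) (p : ℂ) : IsOpen (sameSide N c p) := by
  refine isOpen_biInter_finset fun j _ => isOpen_lt continuous_const ?_
  fun_prop

theorem convex_sameSide (N : ℕ) (c : ℝ) (p : ℂ) : Convex ℝ (sameSide N c p) := by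
  refine convex_iInter₂ fun j _ => ?_
  intro z hz w hw a b ha hb hab
  simp only [mem_ofPred_eq, Complex.add_re, Complex.real_smul, Complex.re_ofReal_mul] at *
  have h : (p.re - (c + j - 1)) * (a * z.re + b * w.re - (c + j - 1)) =
      a * ((p.re - (c + j - 1)) * (z.re - (c + j - 1))) +
      b * ((p.re - (c + j - 1)) * (w.re - (c + j - 1))) := by
    linear_combination ((p.re - (c + j - 1)) * (c + j - 1)) * hab
  rw [h]
  rcases ha.eq_or_lt with rfl | ha
  · rw [zero_add] at hab
    subst hab
    linarith
  · exact add_pos_of_pos_of_nonneg (mul_pos ha hz) (mul_nonneg hb hw.le)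

theorem re_ne_of_mem_sameSide {N : ℕ} {c : ℝ} {p z : ℂ} (hz : z ∈ sameSide N c p) {j : ℕ}
    (hj : j < N) : z.re ≠ c + j - 1 := by
  intro h
  have := mem_iInter₂.1 hz j (Finset.mem_range.2 hj)
  simp [h] at this

theorem range_subset_sameSide {N : ℕ} {c : ℝ} {p : ℂ} {γ : Path p p}
    (hsep : ∀ j : ℕ, j < N → ∀ u, (γ u).re ≠ c + j - 1) : range γ ⊆ sameSide N c p := by
  rintro _ ⟨u, rfl⟩
  refine mem_iInter₂.2 fun j hj => ?_
  have hj' := Finset.mem_range.1 hj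
  by_contra hneg
  have hcont : Continuous fun u => (p.re - (c + j - 1)) * ((γ u).re - (c + j - 1)) := by fun_prop
  have h0 : 0 < (p.re - (c + j - 1)) * ((γ 0).re - (c + j - 1)) := by
    have := hsep j hj' 0
    rw [γ.source] at this ⊢
    exact mul_self_pos.2 (sub_ne_zero.2 this)
  obtain ⟨v, hv⟩ := mem_range_of_exists_le_of_exists_ge hcont ⟨u, not_lt.1 hneg⟩ ⟨0, h0.le⟩
  rcases mul_eq_zero.1 hv with h | h
  · rw [h, zero_mul] at h0
    exact lt_irrefl _ h0
  · exact hsep j hj' v (sub_eq_zero.1 h)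

end CoupledGaussian

end

noncomputable section

namespace CoupledGaussian

open MeasureTheory Set Filter Topology

/-! ### The Gamma function on vertical lines -/

theorem norm_Gamma_le {s : ℂ} (hs : 0 < s.re) : ‖Complex.Gamma s‖ ≤ Real.Gamma s.re := by
  rw [Complex.Gamma_eq_integral hs, Real.Gamma_eq_integral hs, Complex.GammaIntegral]
  refine (norm_integral_le_integral_norm _).trans (le_of_eq ?_)
  refine setIntegral_congr_fun measurableSet_Ioi fun x hx => ?_
  simp only [norm_mul]
  rw [Complex.norm_cpow_eq_rpow_re_of_pos hx, Complex.norm_real, Real.norm_of_nonneg (by positivity)]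
  simp

theorem norm_pow_mul_Gamma_le (d : ℕ) {s : ℂ} (hs : 0 < s.re) :
    ‖s ^ d * Complex.Gamma s‖ ≤ Real.Gamma (s.re + d) := by
  induction d generalizing s with
  | zero => simpa using norm_Gamma_le hs
  | succ d ih =>
    have hs0 : s ≠ 0 := by rintro rfl; simp at hs
    have h := ih (s := s + 1) (by simp; linarith)
    rw [Complex.Gamma_add_one s hs0] at h
    have hle : ‖s‖ ≤ ‖s + 1‖ := by
      rw [Complex.norm_def, Complex.norm_def]
      refine Real.sqrt_le_sqrt ?_
      simp only [Complex.normSq_apply, Complex.add_re, Complex.one_re, Complex.add_im,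
        Complex.one_im]
      nlinarith
    calc ‖s ^ (d + 1) * Complex.Gamma s‖ = ‖s‖ ^ d * ‖s * Complex.Gamma s‖ := by
          rw [pow_succ, mul_assoc, norm_mul, norm_pow]
      _ ≤ ‖s + 1‖ ^ d * ‖s * Complex.Gamma s‖ := by gcongr
      _ = ‖(s + 1) ^ d * (s * Complex.Gamma s)‖ := by rw [norm_mul ((s + 1) ^ d), norm_pow]
      _ ≤ _ := h
      _ = _ := by
        congr 1; push_cast; simp; ring

theorem exists_norm_eval_mul_Gamma_le (P : Polynomial ℂ) {c : ℝ} (hc : 0 < c) :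
    ∃ B : ℝ, ∀ s : ℂ, s.re = c → ‖P.eval s * Complex.Gamma s‖ ≤ B := by
  refine ⟨∑ i ∈ Finset.range (P.natDegree + 1), ‖P.coeff i‖ * Real.Gamma (c + i),
    fun s hs => ?_⟩
  rw [Polynomial.eval_eq_sum_range, Finset.sum_mul]
  refine (norm_sum_le _ _).trans (Finset.sum_le_sum fun i _ => ?_)
  rw [mul_assoc, norm_mul, ← hs]
  exact mul_le_mul_of_nonneg_left (norm_pow_mul_Gamma_le i (hs ▸ hc)) (norm_nonneg _)

theorem continuous_Gamma_vertical {c : ℝ} (hc : 0 < c) :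
    Continuous fun v : ℝ => Complex.Gamma (c + v * Complex.I) := by
  rw [continuous_iff_continuousAt]
  intro v
  have h : ContinuousAt Complex.Gamma ((c : ℂ) + v * Complex.I) := by
    refine (Complex.differentiableAt_Gamma _ fun m hm => ?_).continuousAt
    have := congr_arg Complex.re hm
    simp at this
    have h0 : (0 : ℝ) ≤ m := Nat.cast_nonneg m
    linarith
  exact h.comp (f := fun v : ℝ => (c : ℂ) + v * Complex.I) (by fun_prop)

theorem integrable_inv_add_sq {c : ℝ} (hc : 0 < c) :
    Integrable fun v : ℝ => (c ^ 2 + v ^ 2)⁻¹ := by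
  have h := (integrable_inv_one_add_sq.comp_div hc.ne').const_mul (c ^ 2)⁻¹
  refine h.congr (Eventually.of_forall fun v => ?_)
  have : 0 < c ^ 2 + v ^ 2 := by positivity
  simp only
  field_simp

theorem integrable_eval_mul_Gamma_mul (P : Polynomial ℂ) {c : ℝ} (hc : 0 < c) {g : ℝ → ℂ}
    (hg : AEStronglyMeasurable g) {B : ℝ} (hB : ∀ v, ‖g v‖ ≤ B) :
    Integrable fun v : ℝ => P.eval ((c : ℂ) + v * Complex.I) *
      Complex.Gamma (c + v * Complex.I) * g v := by
  obtain ⟨A, hA⟩ := exists_norm_eval_mul_Gamma_le (P * Polynomial.X ^ 2) hc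
  refine ((integrable_inv_add_sq hc).const_mul (A * B)).mono' ?_ (Eventually.of_forall fun v => ?_)
  · refine AEStronglyMeasurable.mul ?_ hg
    exact ((P.continuous.comp (by fun_prop)).mul
      (continuous_Gamma_vertical hc)).aestronglyMeasurable
  · have h := hA ((c : ℂ) + v * Complex.I) (by simp)
    have hn : ‖(c : ℂ) + v * Complex.I‖ ^ 2 = c ^ 2 + v ^ 2 := by
      rw [← Complex.normSq_eq_norm_sq, Complex.normSq_add_mul_I]
    have hpos : 0 < c ^ 2 + v ^ 2 := by positivity
    rw [Polynomial.eval_mul, Polynomial.eval_pow, Polynomial.eval_X, mul_right_comm, norm_mul,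
      norm_pow, hn] at h
    rw [norm_mul, mul_right_comm, ← div_eq_mul_inv]
    refine mul_le_mul ((le_div_iff₀ hpos).2 h) (hB v) (norm_nonneg _) ?_
    exact div_nonneg ((by positivity : (0 : ℝ) ≤ _).trans h) hpos.le

theorem norm_cpow_vertical {r : ℝ} (hr : 0 < r) (c v : ℝ) :
    ‖(r : ℂ) ^ (-((c : ℂ) + v * Complex.I))‖ = r ^ (-c) := by
  rw [Complex.norm_cpow_eq_rpow_re_of_pos hr]
  simp

theorem continuous_cpow_vertical {r : ℝ} (hr : 0 < r) (c : ℝ) :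
    Continuous fun v : ℝ => (r : ℂ) ^ (-((c : ℂ) + v * Complex.I)) := by
  refine Continuous.const_cpow (by fun_prop) (Or.inl ?_)
  exact_mod_cast hr.ne'

theorem integrable_eval_mul_Gamma_mul_Gamma (P : Polynomial ℂ) (κ : ℕ) {c r : ℝ} (hc : 0 < c)
    (hr : 0 < r) {g : ℝ → ℂ} (hg : AEStronglyMeasurable g) {B : ℝ} (hB : ∀ v, ‖g v‖ ≤ B) :
    Integrable fun v : ℝ => P.eval ((c : ℂ) + v * Complex.I) *
      Complex.Gamma (c + v * Complex.I) * (Complex.Gamma (c + v * Complex.I + κ) *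
        (r : ℂ) ^ (-((c : ℂ) + v * Complex.I)) * g v) := by
  have hcκ : 0 < c + κ := by positivity
  refine integrable_eval_mul_Gamma_mul P hc (B := Real.Gamma (c + κ) * r ^ (-c) * B) ?_ fun v => ?_
  · refine AEStronglyMeasurable.mul (Continuous.aestronglyMeasurable ?_) hg
    refine Continuous.mul ?_ (continuous_cpow_vertical hr c)
    have := continuous_Gamma_vertical hcκ
    push_cast at this
    simpa only [add_right_comm] using this
  · have h0 := norm_Gamma_le (s := c + v * Complex.I + κ) (by simpa using hcκ)
    have h1 : (c + v * Complex.I + κ : ℂ).re = c + κ := by simp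
    rw [h1] at h0
    rw [norm_mul, norm_mul, norm_cpow_vertical hr]
    have := Real.Gamma_pos_of_pos hcκ
    gcongr
    exact hB v

theorem integrable_Gamma_mul_Gamma (P : Polynomial ℂ) (κ : ℕ) {c r : ℝ} (hc : 0 < c)
    (hr : 0 < r) :
    Integrable fun v : ℝ => P.eval ((c : ℂ) + v * Complex.I) *
      (Complex.Gamma (c + v * Complex.I) * Complex.Gamma (c + v * Complex.I + κ) *
        (r : ℂ) ^ (-((c : ℂ) + v * Complex.I))) := by
  have h := integrable_eval_mul_Gamma_mul_Gamma P κ hc hr (g := fun _ => 1)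
    aestronglyMeasurable_const (B := 1) (by simp)
  refine h.congr (Eventually.of_forall fun v => ?_)
  simp only
  ring

/-! ### The Mellin transform of the Bessel functions of the second kind -/

/-- `x^κ ∫_0^∞ exp(-t - b x / t) t^{-κ-1} dt`, which is `2 b^{-κ/2} x^{κ/2} K_κ(2 √(b x))`. -/
def scaledBesselK (κ : ℕ) (b x : ℝ) : ℝ :=
  x ^ κ * ∫ t in Ioi (0 : ℝ), Real.exp (-t - b * x / t) / t ^ (κ + 1)

theorem scaledBesselK_nonneg (κ : ℕ) (b : ℝ) {x : ℝ} (hx : 0 ≤ x) : 0 ≤ scaledBesselK κ b x := by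
  refine mul_nonneg (pow_nonneg hx _) (setIntegral_nonneg measurableSet_Ioi fun t ht => ?_)
  have : 0 < t := ht
  positivity

theorem integrableOn_rpow_mul_exp {σ r : ℝ} (hσ : 0 < σ) (hr : 0 < r) :
    IntegrableOn (fun x : ℝ => x ^ (σ - 1) * Real.exp (-(r * x))) (Ioi 0) := by
  have h := integrableOn_rpow_mul_exp_neg_mul_rpow (p := 1) (s := σ - 1) (b := r)
    (by linarith) one_pos hr
  simpa using h

/-- The integrand of the double integral for the Mellin transform of `scaledBesselK`. -/
def besselMellinIntegrand (κ : ℕ) (b : ℝ) (s : ℂ) (x t : ℝ) : ℂ :=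
  (x : ℂ) ^ (s - 1) * ((x ^ κ * (Real.exp (-t - b * x / t) / t ^ (κ + 1)) : ℝ) : ℂ)

theorem norm_besselMellinIntegrand (κ : ℕ) (b : ℝ) (s : ℂ) {x t : ℝ} (hx : 0 < x) (ht : 0 < t) :
    ‖besselMellinIntegrand κ b s x t‖ =
      Real.exp (-t) / t ^ (κ + 1) * (x ^ (s.re + κ - 1) * Real.exp (-(b / t * x))) := by
  rw [besselMellinIntegrand, norm_mul, Complex.norm_cpow_eq_rpow_re_of_pos hx, Complex.norm_real,
    Real.norm_of_nonneg (by positivity), show s.re + κ - 1 = (s.re - 1) + κ by ring,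
    Real.rpow_add hx, Real.rpow_natCast, sub_eq_add_neg (-t), Real.exp_add,
    show -(b * x / t) = -(b / t * x) by ring]
  simp only [Complex.sub_re, Complex.one_re]
  ring

theorem besselMellinIntegrand_eq (κ : ℕ) (b : ℝ) (s : ℂ) {x : ℝ} (hx : 0 < x) (t : ℝ) :
    besselMellinIntegrand κ b s x t =
      (Real.exp (-t) / t ^ (κ + 1) : ℝ) *
        ((x : ℂ) ^ (s + κ - 1) * Complex.exp (-((b / t : ℝ) * x))) := by
  have hx' : (x : ℂ) ≠ 0 := by exact_mod_cast hx.ne'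
  rw [besselMellinIntegrand, show s + κ - 1 = (s - 1) + κ by ring, Complex.cpow_add _ _ hx',
    Complex.cpow_natCast, sub_eq_add_neg (-t), Real.exp_add,
    show -(b * x / t) = -(b / t * x) by ring]
  push_cast
  ring

theorem rpow_inv_div_eq {b t : ℝ} (hb : 0 < b) (ht : 0 < t) (σ : ℝ) (κ : ℕ) :
    Real.exp (-t) / t ^ (κ + 1) * (1 / (b / t)) ^ (σ + κ) =
      b ^ (-(σ + κ)) * (Real.exp (-t) * t ^ (σ - 1)) := by
  rw [one_div_div, Real.div_rpow ht.le hb.le, Real.rpow_neg hb.le,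
    show σ + κ = (σ - 1) + ((κ + 1 : ℕ) : ℝ) by push_cast; ring, Real.rpow_add ht,
    Real.rpow_natCast]
  field_simp

theorem cpow_inv_div_eq {b t : ℝ} (hb : 0 < b) (ht : 0 < t) (s : ℂ) (κ : ℕ) :
    ((Real.exp (-t) / t ^ (κ + 1) : ℝ) : ℂ) * (1 / ((b / t : ℝ) : ℂ)) ^ (s + κ) =
      (b : ℂ) ^ (-(s + κ)) * ((Real.exp (-t) : ℝ) * (t : ℂ) ^ (s - 1)) := by
  have ht' : (t : ℂ) ≠ 0 := by exact_mod_cast ht.ne'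
  have e : (1 / ((b / t : ℝ) : ℂ)) = ((t * b⁻¹ : ℝ) : ℂ) := by
    push_cast; rw [one_div_div, div_eq_mul_inv]
  rw [e, Complex.ofReal_mul, Complex.mul_cpow_ofReal_nonneg ht.le (inv_nonneg.2 hb.le),
    Complex.ofReal_inv, Complex.inv_cpow _ _ (by
      rw [Complex.arg_ofReal_of_nonneg hb.le]; exact Real.pi_pos.ne), Complex.cpow_neg,
    show s + κ = (s - 1) + ((κ + 1 : ℕ) : ℂ) by push_cast; ring, Complex.cpow_add _ _ ht',
    Complex.cpow_natCast]
  push_cast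
  field_simp

theorem integrableOn_besselMellinIntegrand {κ : ℕ} {b : ℝ} (hb : 0 < b) {s : ℂ} (hs : 0 < s.re) :
    Integrable (Function.uncurry (besselMellinIntegrand κ b s))
      ((volume.restrict (Ioi 0)).prod (volume.restrict (Ioi 0))) := by
  have hmeas : Measurable (Function.uncurry (besselMellinIntegrand κ b s)) := by
    unfold besselMellinIntegrand Function.uncurry
    fun_prop
  have hsκ : 0 < s.re + κ := by positivity
  rw [integrable_prod_iff' hmeas.aestronglyMeasurable]
  constructor
  · filter_upwards [ae_restrict_mem measurableSet_Ioi] with t ht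
    have ht : 0 < t := ht
    have h := (integrableOn_rpow_mul_exp hsκ (div_pos hb ht)).const_mul
      (Real.exp (-t) / t ^ (κ + 1))
    refine Integrable.mono' h (by
      have := hmeas.comp (measurable_prodMk_right (y := t))
      exact this.aestronglyMeasurable) ?_
    filter_upwards [ae_restrict_mem measurableSet_Ioi] with x hx
    exact (norm_besselMellinIntegrand κ b s hx ht).le
  · have h := (Real.GammaIntegral_convergent hs).const_mul
      (b ^ (-(s.re + κ)) * Real.Gamma (s.re + κ))
    refine h.congr ?_
    filter_upwards [ae_restrict_mem measurableSet_Ioi] with t ht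
    have ht : 0 < t := ht
    have e : ∫ x in Ioi (0 : ℝ), ‖Function.uncurry (besselMellinIntegrand κ b s) (x, t)‖ =
        ∫ x in Ioi (0 : ℝ), Real.exp (-t) / t ^ (κ + 1) *
          (x ^ (s.re + κ - 1) * Real.exp (-(b / t * x))) :=
      setIntegral_congr_fun measurableSet_Ioi fun x hx =>
        norm_besselMellinIntegrand κ b s hx ht
    rw [e, integral_const_mul, Real.integral_rpow_mul_exp_neg_mul_Ioi hsκ (div_pos hb ht)]
    linear_combination -Real.Gamma (s.re + κ) * rpow_inv_div_eq hb ht s.re κ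

theorem hasMellin_scaledBesselK {κ : ℕ} {b : ℝ} (hb : 0 < b) {s : ℂ} (hs : 0 < s.re) :
    HasMellin (fun x => (scaledBesselK κ b x : ℂ)) s
      ((b : ℂ) ^ (-(s + κ)) * (Complex.Gamma s * Complex.Gamma (s + κ))) := by
  have hint := integrableOn_besselMellinIntegrand (κ := κ) hb hs
  have hinner : ∀ x : ℝ, (x : ℂ) ^ (s - 1) • (scaledBesselK κ b x : ℂ) =
      ∫ t in Ioi (0 : ℝ), besselMellinIntegrand κ b s x t := by
    intro x
    simp only [besselMellinIntegrand, smul_eq_mul]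
    rw [integral_const_mul, integral_complex_ofReal, integral_const_mul, scaledBesselK]
  have hsκ : 0 < (s + κ).re := by
    simp only [Complex.add_re, Complex.natCast_re]
    positivity
  refine ⟨?_, ?_⟩
  · have h := hint.integral_prod_left
    rw [MellinConvergent]
    exact h.congr (Eventually.of_forall fun x => (hinner x).symm)
  · rw [mellin]
    simp_rw [hinner]
    rw [integral_integral_swap hint]
    have e : ∫ t in Ioi (0 : ℝ), ∫ x in Ioi (0 : ℝ), besselMellinIntegrand κ b s x t =
        ∫ t in Ioi (0 : ℝ), ((b : ℂ) ^ (-(s + κ)) * Complex.Gamma (s + κ)) *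
          ((Real.exp (-t) : ℝ) * (t : ℂ) ^ (s - 1)) := by
      refine setIntegral_congr_fun measurableSet_Ioi fun t ht => ?_
      have ht : 0 < t := ht
      have e2 : ∫ x in Ioi (0 : ℝ), besselMellinIntegrand κ b s x t =
          ∫ x in Ioi (0 : ℝ), ((Real.exp (-t) / t ^ (κ + 1) : ℝ) : ℂ) *
            ((x : ℂ) ^ (s + κ - 1) * Complex.exp (-((b / t : ℝ) * x))) :=
        setIntegral_congr_fun measurableSet_Ioi fun x hx => besselMellinIntegrand_eq κ b s hx t
      rw [e2, integral_const_mul, Complex.integral_cpow_mul_exp_neg_mul_Ioi hsκ (div_pos hb ht),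
        ← mul_assoc, cpow_inv_div_eq hb ht]
      ring
    rw [e, integral_const_mul]
    have hG := Complex.Gamma_eq_integral hs
    rw [Complex.GammaIntegral] at hG
    rw [← hG]
    ring

theorem exp_div_pow_le (κ : ℕ) {a t : ℝ} (ha : 0 < a) (ht : 0 < t) :
    Real.exp (-t - a / t) / t ^ (κ + 1) ≤ (κ + 1)! / a ^ (κ + 1) * Real.exp (-t) := by
  have h := Real.pow_div_factorial_le_exp (x := a / t) (by positivity) (κ + 1)
  rw [div_pow, div_div, div_le_iff₀ (by positivity)] at h
  rw [sub_eq_add_neg, Real.exp_add, Real.exp_neg (a / t), div_mul_eq_mul_div,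
    div_le_div_iff₀ (by positivity) (by positivity)]
  have hpos := Real.exp_pos (a / t)
  rw [mul_assoc, mul_assoc, mul_comm ((κ + 1)! : ℝ), mul_assoc]
  refine mul_le_mul_of_nonneg_left ?_ (Real.exp_pos _).le
  rw [inv_mul_le_iff₀ hpos]
  calc a ^ (κ + 1) ≤ _ := h
    _ = _ := by ring

theorem continuousAt_scaledBesselK (κ : ℕ) {b y : ℝ} (hb : 0 < b) (hy : 0 < y) :
    ContinuousAt (scaledBesselK κ b) y := by
  unfold scaledBesselK
  refine (continuousAt_id.pow κ).mul ?_
  refine continuousAt_of_dominated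
    (bound := fun t => (κ + 1)! / (b * (y / 2)) ^ (κ + 1) * Real.exp (-t)) ?_ ?_ ?_ ?_
  · refine Eventually.of_forall fun x => Measurable.aestronglyMeasurable ?_
    fun_prop
  · filter_upwards [lt_mem_nhds (half_lt_self hy)] with x hx
    filter_upwards [ae_restrict_mem measurableSet_Ioi] with t ht
    have ht : 0 < t := ht
    rw [Real.norm_of_nonneg (by positivity)]
    refine le_trans ?_ (exp_div_pow_le κ (by positivity) ht)
    gcongr
  · have h := (Real.GammaIntegral_convergent (one_pos)).const_mul
      ((κ + 1)! / (b * (y / 2)) ^ (κ + 1) : ℝ)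
    simpa [IntegrableOn] using h
  · refine Eventually.of_forall fun t => ?_
    fun_prop

theorem phi_eq_scaledBesselK (ν : ℕ) (μ : ℝ) (j : ℕ) {x : ℝ} (hx : 0 < x) :
    phi ν μ j x = 1 / 2 * alpha μ ^ (j + ν) * scaledBesselK (j + ν) (alpha μ ^ 2) x := by
  have h1 : x ^ (((j : ℝ) + ν) / 2) * √x ^ (j + ν) = x ^ (j + ν) := by
    rw [Real.sqrt_eq_rpow, ← Real.rpow_natCast, ← Real.rpow_mul hx.le, ← Real.rpow_add hx,
      ← Real.rpow_natCast]
    congr 1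
    push_cast; ring
  have h2 : ∀ t : ℝ, (2 * alpha μ * √x) ^ 2 / (4 * t) = alpha μ ^ 2 * x / t := by
    intro t
    rw [mul_pow, Real.sq_sqrt hx.le, mul_pow, mul_assoc,
      show (2 : ℝ) ^ 2 = 4 by norm_num, mul_div_mul_left _ _ (by norm_num)]
  rw [phi, besselK, scaledBesselK, ← h1, show 2 * alpha μ * √x / 2 = alpha μ * √x by ring, mul_pow]
  simp_rw [h2]
  ring

theorem phi_nonneg (ν : ℕ) {μ : ℝ} (hα : 0 < alpha μ) (j : ℕ) {x : ℝ} (hx : 0 < x) :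
    0 ≤ phi ν μ j x := by
  rw [phi_eq_scaledBesselK ν μ j hx]
  have := scaledBesselK_nonneg (j + ν) (alpha μ ^ 2) hx.le
  positivity

theorem hasMellin_phi (ν : ℕ) {μ : ℝ} (hα : 0 < alpha μ) (j : ℕ) {s : ℂ} (hs : 0 < s.re) :
    HasMellin (fun x => (phi ν μ j x : ℂ)) s
      ((2 * (alpha μ : ℂ) ^ (j + ν))⁻¹ * ((alpha μ ^ 2 : ℝ) : ℂ) ^ (-s) *
        (Complex.Gamma s * Complex.Gamma (s + (j + ν : ℕ)))) := by
  have hα' : (alpha μ : ℂ) ≠ 0 := by exact_mod_cast hα.ne'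
  have h := hasMellin_scaledBesselK (κ := j + ν) (b := alpha μ ^ 2) (by positivity) hs
  have e : EqOn (fun x : ℝ => (x : ℂ) ^ (s - 1) • (phi ν μ j x : ℂ))
      (fun x : ℝ => (1 / 2 * (alpha μ : ℂ) ^ (j + ν)) *
        ((x : ℂ) ^ (s - 1) • (scaledBesselK (j + ν) (alpha μ ^ 2) x : ℂ))) (Ioi 0) := by
    intro x hx
    simp only [smul_eq_mul]
    rw [phi_eq_scaledBesselK ν μ j hx]
    push_cast; ring
  refine ⟨?_, ?_⟩
  · exact IntegrableOn.congr_fun (h.1.const_mul _) e.symm measurableSet_Ioi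
  · have h2 := h.2
    rw [mellin] at h2 ⊢
    rw [setIntegral_congr_fun measurableSet_Ioi e, integral_const_mul, h2, neg_add,
      Complex.cpow_add _ _ (by exact_mod_cast (pow_pos hα 2).ne'), Complex.cpow_neg _ ((j + ν : ℕ) : ℂ),
      Complex.cpow_natCast]
    have e3 : (((alpha μ ^ 2 : ℝ) : ℂ) ^ (j + ν)) =
        (alpha μ : ℂ) ^ (j + ν) * (alpha μ : ℂ) ^ (j + ν) := by
      push_cast; ring
    rw [e3]
    field_simp

theorem continuousAt_phi (ν : ℕ) {μ : ℝ} (hα : 0 < alpha μ) (j : ℕ) {y : ℝ} (hy : 0 < y) :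
    ContinuousAt (phi ν μ j) y := by
  have h := (continuousAt_scaledBesselK (j + ν) (pow_pos hα 2) hy).const_mul
    (1 / 2 * alpha μ ^ (j + ν))
  refine h.congr ?_
  filter_upwards [lt_mem_nhds hy] with x hx
  exact (phi_eq_scaledBesselK ν μ j hx).symm

theorem phi_eq_verticalIntegral (ν : ℕ) {μ : ℝ} (hα : 0 < alpha μ) (j : ℕ) {y c : ℝ} (hy : 0 < y)
    (hc : 0 < c) :
    verticalIntegral c (fun s => Complex.Gamma s * Complex.Gamma (s + (j + ν : ℕ)) *
      ((alpha μ ^ 2 * y : ℝ) : ℂ) ^ (-s)) =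
      2 * Real.pi * Complex.I * (2 * (alpha μ : ℂ) ^ (j + ν) * phi ν μ j y) := by
  have hα' : (alpha μ : ℂ) ≠ 0 := by exact_mod_cast hα.ne'
  have hm : ∀ v : ℝ, mellin (fun x => (phi ν μ j x : ℂ)) (c + v * Complex.I) =
      (2 * (alpha μ : ℂ) ^ (j + ν))⁻¹ *
        ((alpha μ ^ 2 : ℝ) : ℂ) ^ (-((c : ℂ) + v * Complex.I)) *
        (Complex.Gamma (c + v * Complex.I) *
          Complex.Gamma (c + v * Complex.I + (j + ν : ℕ))) := fun v =>
    (hasMellin_phi ν hα j (by simpa using hc)).2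
  have hinv := mellinInv_mellin_eq c (fun x => (phi ν μ j x : ℂ)) hy
    (hasMellin_phi ν hα j (by simpa using hc)).1 ?_ ?_
  · rw [mellinInv] at hinv
    have e : ∀ v : ℝ, (y : ℂ) ^ (-((c : ℂ) + v * Complex.I)) •
        mellin (fun x => (phi ν μ j x : ℂ)) (c + v * Complex.I) =
        (2 * (alpha μ : ℂ) ^ (j + ν))⁻¹ * (Complex.Gamma (c + v * Complex.I) *
          Complex.Gamma (c + v * Complex.I + (j + ν : ℕ)) *
          ((alpha μ ^ 2 * y : ℝ) : ℂ) ^ (-((c : ℂ) + v * Complex.I))) := by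
      intro v
      rw [hm, Complex.ofReal_mul, Complex.mul_cpow_ofReal_nonneg (by positivity) hy.le, smul_eq_mul]
      ring
    simp_rw [e] at hinv
    rw [integral_const_mul] at hinv
    rw [verticalIntegral, ← hinv, Complex.real_smul]
    have hpi : (Real.pi : ℂ) ≠ 0 := by exact_mod_cast Real.pi_pos.ne'
    push_cast
    field_simp
  · rw [Complex.VerticalIntegrable]
    have h := (integrable_Gamma_mul_Gamma 1 (j + ν) hc (pow_pos hα 2)).const_mul
      (2 * (alpha μ : ℂ) ^ (j + ν))⁻¹
    refine h.congr (Eventually.of_forall fun v => ?_)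
    simp only [hm, Polynomial.eval_one]
    ring
  · exact Complex.continuous_ofReal.continuousAt.comp (continuousAt_phi ν hα j hy)

theorem integral_pow_mul_phi (ν : ℕ) {μ : ℝ} (hα : 0 < alpha μ) (j n : ℕ) :
    IntegrableOn (fun x => x ^ n * phi ν μ j x) (Ioi 0) ∧
    ∫ x in Ioi (0 : ℝ), x ^ n * phi ν μ j x =
      (2 * alpha μ ^ (j + ν))⁻¹ * (alpha μ ^ (2 * (n + 1)))⁻¹ * (n ! * (n + (j + ν))! : ℝ) := by
  have h := hasMellin_phi ν hα j (s := (n : ℂ) + 1) (by simp; positivity)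
  have e : ∀ x : ℝ, (x : ℂ) ^ ((n : ℂ) + 1 - 1) • (phi ν μ j x : ℂ) =
      ((x ^ n * phi ν μ j x : ℝ) : ℂ) := by
    intro x
    rw [add_sub_cancel_right, Complex.cpow_natCast]
    push_cast
    rfl
  constructor
  · have h1 := h.1
    rw [MellinConvergent] at h1
    simp_rw [e] at h1
    exact_mod_cast h1.re
  · have h2 := h.2
    rw [mellin] at h2
    simp_rw [e] at h2
    rw [integral_complex_ofReal, Complex.Gamma_nat_eq_factorial,
      show (n : ℂ) + 1 + ((j + ν : ℕ) : ℂ) = ((n + (j + ν) : ℕ) : ℂ) + 1 by push_cast; ring,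
      Complex.Gamma_nat_eq_factorial, Complex.cpow_neg,
      show (n : ℂ) + 1 = ((n + 1 : ℕ) : ℂ) by push_cast; ring, Complex.cpow_natCast] at h2
    apply Complex.ofReal_injective
    rw [h2]
    push_cast
    rw [← pow_mul]

end CoupledGaussian

end

noncomputable section

namespace CoupledGaussian

open MeasureTheory Set Filter Topology Polynomial

/-! ### Moments -/

theorem summable_eval_mul_geometric (P : ℂ[X]) {q : ℂ} (hq : ‖q‖ < 1) :
    Summable fun M : ℕ => P.eval (M : ℂ) * q ^ M := by
  simp_rw [Polynomial.eval_eq_sum_range, Finset.sum_mul]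
  refine summable_sum fun i _ => ?_
  simp_rw [mul_assoc]
  exact (summable_pow_mul_geometric_of_norm_lt_one i hq).mul_left _

/-- The polynomial `∑_k q^k (s + ν)_k R_k(s - 1)`. -/
def mellinPoly (N ν n : ℕ) (q : ℂ) : ℂ[X] :=
  ∑ k ∈ Finset.range N, C (q ^ k) * (ascPochhammer ℂ k).comp (X + C (ν : ℂ)) *
    (residuePoly N n k).comp (X - C 1)

theorem eval_mellinPoly (N ν n : ℕ) (q s : ℂ) :
    (mellinPoly N ν n q).eval s = ∑ k ∈ Finset.range N,
      q ^ k * (ascPochhammer ℂ k).eval (s + ν) * (residuePoly N n k).eval (s - 1) := by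
  simp [mellinPoly, eval_finsetSum]

theorem degree_mellinPoly {N n : ℕ} (ν : ℕ) (q : ℂ) (hn : n < N) :
    (mellinPoly N ν n q).degree < (N : WithBot ℕ) := by
  rw [← mem_degreeLT]
  refine Submodule.sum_mem _ fun k hk => mem_degreeLT.2 ?_
  rw [Finset.mem_range] at hk
  have hR := degree_residuePoly hn hk
  by_cases h0 : residuePoly N n k = 0
  · rw [h0, zero_comp, mul_zero, degree_zero]
    exact WithBot.bot_lt_coe N
  · have h1 : (residuePoly N n k).natDegree < N - k := by
      rw [degree_eq_natDegree h0] at hR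
      exact_mod_cast hR
    have h2 : (C (q ^ k) * (ascPochhammer ℂ k).comp (X + C (ν : ℂ)) *
        (residuePoly N n k).comp (X - C 1)).natDegree ≤ k + (residuePoly N n k).natDegree := by
      refine natDegree_mul_le.trans (add_le_add ?_ ?_)
      · refine (natDegree_C_mul_le _ _).trans ?_
        rw [natDegree_comp, ascPochhammer_natDegree, natDegree_X_add_C, mul_one]
      · rw [natDegree_comp, natDegree_X_sub_C, mul_one]
    refine degree_le_natDegree.trans_lt ?_
    exact_mod_cast (by omega : _ < N)

theorem exists_mellinPoly_eq_sum {N n : ℕ} (ν : ℕ) (q : ℂ) (hn : n < N) :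
    ∃ d : ℕ → ℂ, ∀ s, (mellinPoly N ν n q).eval s =
      ∑ l ∈ Finset.range N, d l * (ascPochhammer ℂ l).eval (s + ν) := by
  obtain ⟨d, hd⟩ := exists_eq_sum_of_degree_lt
    (b := fun l => (ascPochhammer ℂ l).comp (X + C (ν : ℂ)))
    (fun l => (monic_ascPochhammer ℂ l).comp (monic_X_add_C _)
      (by rw [natDegree_X_add_C]; exact one_ne_zero))
    (fun l => by rw [natDegree_comp, ascPochhammer_natDegree, natDegree_X_add_C, mul_one])
    (degree_mellinPoly ν q hn)
  exact ⟨d, fun s => by rw [hd]; simp [eval_finsetSum]⟩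

theorem hasSum_congr {f g : ℕ → ℂ} {a : ℂ} (h : ∀ i, f i = g i) : HasSum f a ↔ HasSum g a := by
  rw [funext h]

theorem hasSum_comp_add_of_eq_zero {f : ℕ → ℂ} {a : ℂ} (hf : HasSum f a) {m : ℕ}
    (h0 : ∀ i < m, f i = 0) : HasSum (fun i => f (i + m)) a := by
  have h := (hasSum_nat_add_iff' m).2 hf
  rwa [Finset.sum_eq_zero fun i hi => h0 i (Finset.mem_range.1 hi), sub_zero] at h

theorem factorial_mul_ascPochhammer_add (a l : ℕ) :
    (a ! : ℂ) * (ascPochhammer ℂ l).eval ((a : ℂ) + 1) = ((a + l)! : ℂ) :=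
  factorial_mul_ascPochhammer ℂ a l

theorem falling_add_natCast (i m : ℕ) :
    falling m ((i + m : ℕ) : ℂ) = ((i + m)! : ℂ) / i ! := by
  rw [falling_natCast, eq_div_iff (by exact_mod_cast i.factorial_ne_zero)]
  have := Nat.factorial_mul_descFactorial (Nat.le_add_left m i)
  rw [Nat.add_sub_cancel] at this
  rw [← this]; push_cast; ring

theorem hasSum_falling_geometric (ν n : ℕ) {q : ℂ} (hq : ‖q‖ < 1) :
    HasSum (fun M : ℕ => q ^ M * (ascPochhammer ℂ ν).eval ((M : ℂ) + 1) * falling n M)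
      (q ^ n * (n + ν)! / (1 - q) ^ (n + ν + 1)) := by
  set f : ℕ → ℂ := fun M => q ^ M * (ascPochhammer ℂ ν).eval ((M : ℂ) + 1) * falling n M with hf
  have h0 : ∀ i < n, f i = 0 := fun i hi => by
    simp only [hf]; rw [falling_natCast_of_lt hi, mul_zero]
  have h1 : HasSum (fun i => f (i + n)) (q ^ n * (n + ν)! / (1 - q) ^ (n + ν + 1)) := by
    have h := (hasSum_choose_mul_geometric_of_norm_lt_one (n + ν) hq).mul_left (q ^ n * (n + ν)!)
    rw [mul_one_div] at h
    refine (hasSum_congr fun i => ?_).2 h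
    simp only [hf]
    rw [falling_add_natCast]
    have e1 := factorial_mul_ascPochhammer_add (i + n) ν
    have e2 : (((i + (n + ν)).choose (n + ν) : ℕ) : ℂ) * ((n + ν)! : ℂ) * (i ! : ℂ) =
        ((i + n + ν)! : ℂ) := by
      have := Nat.add_choose_mul_factorial_mul_factorial i (n + ν)
      rw [show i + n + ν = i + (n + ν) by ring, ← this]
      push_cast; ring
    have hi : (i ! : ℂ) ≠ 0 := by exact_mod_cast i.factorial_ne_zero
    rw [pow_add]
    field_simp
    linear_combination q ^ i * q ^ n * (e1 - e2)
  have h2 := (hasSum_nat_add_iff n).1 h1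
  rwa [Finset.sum_eq_zero fun i hi => h0 i (Finset.mem_range.1 hi), add_zero] at h2

theorem hasSum_mellinPoly {N n j : ℕ} (ν : ℕ) (hn : n < N) (hj : j < N) {q : ℂ} (hq : ‖q‖ < 1) :
    HasSum (fun i : ℕ => q ^ (i + j) / i ! *
        ((i + j + ν)! * (mellinPoly N ν n q).eval ((i + j : ℕ) + 1 : ℂ)))
      (if j = n then (-1) ^ (N - 1 - n) * (n ! * (N - 1 - n)! : ℂ) *
        (q ^ n * (n + ν)! / (1 - q) ^ (n + ν + 1)) else 0) := by
  set w : ℕ → ℂ := fun M => (ascPochhammer ℂ ν).eval ((M : ℂ) + 1) with hw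
  set u : ℕ → ℕ → ℂ := fun k M =>
    q ^ M * w M * (falling (k + j) M * (residuePoly N n k).eval ((M : ℂ) - k)) with hu
  have hsum : ∀ k, Summable (u k) := by
    intro k
    have h := summable_eval_mul_geometric ((ascPochhammer ℂ ν).comp (X + C 1) *
      descPochhammer ℂ (k + j) * (residuePoly N n k).comp (X - C (k : ℂ))) hq
    refine h.congr fun M => ?_
    simp only [hu, hw, eval_mul, eval_comp, eval_add, eval_X, eval_C, eval_sub, falling]
    ring
  have htot : HasSum (fun M => ∑ k ∈ Finset.range N, u k M)
      (if j = n then (-1) ^ (N - 1 - n) * (n ! * (N - 1 - n)! : ℂ) *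
        (q ^ n * (n + ν)! / (1 - q) ^ (n + ν + 1)) else 0) := by
    simp only [hu]
    simp_rw [← Finset.mul_sum, sum_falling_mul_residuePoly hn hj]
    split_ifs with h
    · have h := (hasSum_falling_geometric ν n hq).mul_left
        ((-1) ^ (N - 1 - n) * (n ! * (N - 1 - n)! : ℂ))
      refine (hasSum_congr fun M => ?_).2 h
      simp only [hw]; ring
    · simp [hasSum_zero]
  have hval := (hasSum_sum fun k (_ : k ∈ Finset.range N) => (hsum k).hasSum).unique htot
  rw [← hval]
  have hshift : ∀ k, HasSum (fun i => u k (i + (k + j))) (∑' M, u k M) := fun k =>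
    hasSum_comp_add_of_eq_zero (hsum k).hasSum fun i hi => by
      simp only [hu]; rw [falling_natCast_of_lt hi]; ring
  refine (hasSum_congr fun i => ?_).2 (hasSum_sum fun k (_ : k ∈ Finset.range N) => hshift k)
  rw [eval_mellinPoly, Finset.mul_sum, Finset.mul_sum]
  refine Finset.sum_congr rfl fun k _ => ?_
  simp only [hu, hw]
  rw [falling_add_natCast]
  have e1 := factorial_mul_ascPochhammer_add (i + (k + j)) ν
  have e2 := factorial_mul_ascPochhammer_add (i + j + ν) k
  have e3 : ((i + (k + j) : ℕ) : ℂ) - k = ((i + j : ℕ) : ℂ) + 1 - 1 := by push_cast; ring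
  have e4 : ((i + j : ℕ) : ℂ) + 1 + ν = ((i + j + ν : ℕ) : ℂ) + 1 := by push_cast; ring
  have hi : (i ! : ℂ) ≠ 0 := by exact_mod_cast i.factorial_ne_zero
  rw [e3, e4, show i + (k + j) = (i + j) + k by ring, pow_add q (i + j) k]
  rw [show i + (k + j) + ν = i + j + ν + k by ring, show i + (k + j) = (i + j) + k by ring] at e1
  field_simp
  linear_combination
    q ^ (i + j) * q ^ k * (eval ((i + j : ℕ) + 1 - 1 : ℂ) (residuePoly N n k)) * (e2 - e1)

/-! ### The Gram matrix -/

theorem psi_term (μ : ℝ) (l m : ℕ) {x : ℝ} (hx : 0 < x) :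
    x ^ ((l : ℝ) / 2) * (1 / ((m ! : ℝ) * Real.Gamma (l + m + 1)) *
      (2 * delta μ * √x / 2) ^ (2 * m + l)) =
      delta μ ^ (2 * m + l) / (m ! * (m + l)!) * x ^ (m + l) := by
  have h1 : x ^ ((l : ℝ) / 2) * √x ^ (2 * m + l) = x ^ (m + l) := by
    rw [Real.sqrt_eq_rpow, ← Real.rpow_natCast, ← Real.rpow_mul hx.le, ← Real.rpow_add hx,
      ← Real.rpow_natCast]
    congr 1
    push_cast; ring
  rw [show 2 * delta μ * √x / 2 = delta μ * √x by ring, mul_pow, ← h1,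
    show (l : ℝ) + m + 1 = ((m + l : ℕ) : ℝ) + 1 by push_cast; ring, Real.Gamma_nat_eq_factorial]
  ring

theorem psi_eq_tsum (μ : ℝ) (l : ℕ) {x : ℝ} (hx : 0 < x) :
    psi μ l x = ∑' m : ℕ, delta μ ^ (2 * m + l) / (m ! * (m + l)!) * x ^ (m + l) := by
  rw [psi, besselI, ← tsum_mul_left]
  exact tsum_congr fun m => psi_term μ l m hx

theorem hasSum_gram (ν : ℕ) {μ : ℝ} (hα : 0 < alpha μ) (hδ : 0 < delta μ)
    (hlt : delta μ < alpha μ) (k l : ℕ) :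
    HasSum (fun i : ℕ => (2 * alpha μ ^ (k + ν))⁻¹ *
      (delta μ ^ (2 * i + l) * (alpha μ ^ (2 * (i + l + 1)))⁻¹ * (i + l + (k + ν))! / i !))
      (∫ x in Ioi (0 : ℝ), psi μ l x * phi ν μ k x) := by
  set F : ℕ → ℝ → ℝ := fun i x =>
    delta μ ^ (2 * i + l) / (i ! * (i + l)!) * (x ^ (i + l) * phi ν μ k x) with hF
  have hFi : ∀ i, Integrable (F i) (volume.restrict (Ioi 0)) := fun i =>
    (integral_pow_mul_phi ν hα k (i + l)).1.const_mul _
  have hval : ∀ i, ∫ x in Ioi (0 : ℝ), F i x = (2 * alpha μ ^ (k + ν))⁻¹ *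
      (delta μ ^ (2 * i + l) * (alpha μ ^ (2 * (i + l + 1)))⁻¹ * (i + l + (k + ν))! / i !) := by
    intro i
    simp only [hF]
    rw [integral_const_mul, (integral_pow_mul_phi ν hα k (i + l)).2]
    have h1 : ((i + l)! : ℝ) ≠ 0 := by exact_mod_cast (i + l).factorial_ne_zero
    field_simp
  have hnorm : ∀ i, ∫ x in Ioi (0 : ℝ), ‖F i x‖ = ∫ x in Ioi (0 : ℝ), F i x := by
    intro i
    refine setIntegral_congr_fun measurableSet_Ioi fun x hx => ?_
    have hx' : 0 < x := hx
    have := phi_nonneg ν hα k hx'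
    exact Real.norm_of_nonneg (by simp only [hF]; positivity)
  have hq : ‖(delta μ / alpha μ) ^ 2‖ < 1 := by
    rw [norm_pow, Real.norm_of_nonneg (by positivity)]
    exact pow_lt_one₀ (by positivity) ((div_lt_one hα).2 hlt) two_ne_zero
  have hs : Summable fun i => ∫ x in Ioi (0 : ℝ), ‖F i x‖ := by
    simp_rw [hnorm, hval]
    refine Summable.mul_left _ ?_
    have h := (summable_choose_mul_geometric_of_norm_lt_one (l + (k + ν)) hq).mul_left
      ((l + (k + ν))! * delta μ ^ l * (alpha μ ^ (2 * (l + 1)))⁻¹)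
    refine h.congr fun i => ?_
    have e2 : (((i + (l + (k + ν))).choose (l + (k + ν)) : ℕ) : ℝ) * ((l + (k + ν))! : ℝ) *
        (i ! : ℝ) = ((i + l + (k + ν))! : ℝ) := by
      have := Nat.add_choose_mul_factorial_mul_factorial i (l + (k + ν))
      rw [show i + l + (k + ν) = i + (l + (k + ν)) by ring, ← this]
      push_cast; ring
    have hi : (i ! : ℝ) ≠ 0 := by exact_mod_cast i.factorial_ne_zero
    rw [← e2, div_pow, div_pow, ← pow_mul, ← pow_mul,
      show 2 * (i + l + 1) = 2 * i + 2 * (l + 1) by ring, pow_add, pow_add]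
    field_simp
  have h := hasSum_integral_of_summable_integral_norm hFi hs
  simp_rw [hval] at h
  have e : ∫ x in Ioi (0 : ℝ), psi μ l x * phi ν μ k x = ∫ x in Ioi (0 : ℝ), ∑' i, F i x := by
    refine setIntegral_congr_fun measurableSet_Ioi fun x hx => ?_
    simp only [hF]
    rw [psi_eq_tsum μ l hx, ← tsum_mul_right]
    exact tsum_congr fun i => by ring
  rwa [e]

/-- The constant in front of the `n`-th residue. -/
def residueConst (N ν : ℕ) (μ : ℝ) (n : ℕ) : ℂ :=
  (1 - (delta μ : ℂ) ^ 2 / (alpha μ : ℂ) ^ 2) ^ ν *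
    ((alpha μ : ℂ) ^ 2 - (delta μ : ℂ) ^ 2) ^ (n + 1) *
    ((delta μ : ℂ) ^ n * ((-1) ^ (N - 1 - n) * (n ! * (N - 1 - n)! : ℂ)) * (n + ν)!)⁻¹

theorem sum_residueConst_mul_gram (ν : ℕ) {μ : ℝ} (hα : 0 < alpha μ) (hδ : 0 < delta μ)
    (hlt : delta μ < alpha μ) {N n j : ℕ} (hn : n < N) (hj : j < N) {d : ℕ → ℂ}
    (hd : ∀ s, (mellinPoly N ν n ((delta μ / alpha μ : ℝ) ^ 2)).eval s =
      ∑ l ∈ Finset.range N, d l * (ascPochhammer ℂ l).eval (s + ν)) :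
    ∑ l ∈ Finset.range N, residueConst N ν μ n * (2 * (alpha μ : ℂ) ^ (l + ν)) * d l *
      ((∫ x in Ioi (0 : ℝ), psi μ j x * phi ν μ l x : ℝ) : ℂ) = if n = j then 1 else 0 := by
  set q : ℂ := ((delta μ / alpha μ : ℝ) : ℂ) ^ 2 with hq
  have hq1 : ‖q‖ < 1 := by
    rw [hq, norm_pow, Complex.norm_real, Real.norm_of_nonneg (by positivity)]
    exact pow_lt_one₀ (by positivity) ((div_lt_one hα).2 hlt) two_ne_zero
  have hα' : (alpha μ : ℂ) ≠ 0 := by exact_mod_cast hα.ne'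
  have hδ' : (delta μ : ℂ) ≠ 0 := by exact_mod_cast hδ.ne'
  have hqe : q = (delta μ : ℂ) ^ 2 / (alpha μ : ℂ) ^ 2 := by rw [hq]; push_cast; rw [div_pow]
  have hq0 : 1 - q ≠ 0 := by
    intro h
    rw [← sub_eq_zero.1 h] at hq1
    simp at hq1
  have h1 := hasSum_sum fun l (_ : l ∈ Finset.range N) =>
    (Complex.hasSum_ofReal.2 (hasSum_gram ν hα hδ hlt l j)).mul_left
      (residueConst N ν μ n * (2 * (alpha μ : ℂ) ^ (l + ν)) * d l)
  have h2 := (hasSum_mellinPoly ν hn hj hq1).mul_left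
    (residueConst N ν μ n * ((delta μ : ℂ) ^ j)⁻¹ * ((alpha μ : ℂ) ^ 2)⁻¹)
  have h3 : (if n = j then (1 : ℂ) else 0) =
      residueConst N ν μ n * ((delta μ : ℂ) ^ j)⁻¹ * ((alpha μ : ℂ) ^ 2)⁻¹ *
      (if j = n then (-1) ^ (N - 1 - n) * (n ! * (N - 1 - n)! : ℂ) *
        (q ^ n * (n + ν)! / (1 - q) ^ (n + ν + 1)) else 0) := by
    by_cases hjn : n = j
    · subst hjn
      rw [if_pos rfl, if_pos rfl, residueConst, ← hqe,
        show (alpha μ : ℂ) ^ 2 - (delta μ : ℂ) ^ 2 = (alpha μ : ℂ) ^ 2 * (1 - q) by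
          rw [hqe]; field_simp]
      have f1 : (n ! : ℂ) ≠ 0 := by exact_mod_cast n.factorial_ne_zero
      have f2 : ((N - 1 - n)! : ℂ) ≠ 0 := by exact_mod_cast (N - 1 - n).factorial_ne_zero
      have f3 : ((n + ν)! : ℂ) ≠ 0 := by exact_mod_cast (n + ν).factorial_ne_zero
      have f4 : ((-1 : ℂ)) ^ (N - 1 - n) ≠ 0 := pow_ne_zero _ (by norm_num)
      have f5 : q ^ n = (delta μ : ℂ) ^ n * (delta μ : ℂ) ^ n *
          ((alpha μ : ℂ) ^ 2)⁻¹ ^ n := by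
        rw [hqe, div_eq_mul_inv, mul_pow, ← pow_mul, two_mul, pow_add]
      rw [f5, mul_pow, inv_pow, pow_succ ((alpha μ : ℂ) ^ 2), add_right_comm n ν 1,
        pow_add (1 - q) (n + 1) ν]
      field_simp
    · rw [if_neg hjn, if_neg (Ne.symm hjn), mul_zero]
  rw [h3]
  refine h1.unique ((hasSum_congr fun i => ?_).2 h2)
  rw [hd, Finset.mul_sum, Finset.mul_sum, Finset.mul_sum]
  refine Finset.sum_congr rfl fun l _ => ?_
  have e2 := factorial_mul_ascPochhammer_add (i + j + ν) l
  have e4 : ((i + j : ℕ) : ℂ) + 1 + ν = ((i + j + ν : ℕ) : ℂ) + 1 := by push_cast; ring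
  rw [e4, show i + j + (l + ν) = i + j + ν + l by ring, hqe]
  have hi : (i ! : ℂ) ≠ 0 := by exact_mod_cast i.factorial_ne_zero
  push_cast
  push_cast at e2
  rw [← e2, div_pow, ← pow_mul, ← pow_mul, show 2 * (i + j) = 2 * i + j + j by ring,
    pow_add _ (2 * i + j) j, show 2 * (i + j + 1) = 2 * i + j + j + 2 by ring,
    pow_add _ (2 * i + j + j) 2]
  field_simp

theorem correlationKernel_eq (ν : ℕ) {μ : ℝ} (hα : 0 < alpha μ) (hδ : 0 < delta μ)
    (hlt : delta μ < alpha μ) {N : ℕ} {d : ℕ → ℕ → ℂ}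
    (hd : ∀ n < N, ∀ s, (mellinPoly N ν n ((delta μ / alpha μ : ℝ) ^ 2)).eval s =
      ∑ l ∈ Finset.range N, d n l * (ascPochhammer ℂ l).eval (s + ν)) (x y : ℝ) :
    (correlationKernel N ν μ x y : ℂ) = ∑ n ∈ Finset.range N,
      residueConst N ν μ n * psi μ n x * ∑ l ∈ Finset.range N,
        d n l * (2 * (alpha μ : ℂ) ^ (l + ν) * phi ν μ l y) := by
  set G : Matrix (Fin N) (Fin N) ℂ := (gramMatrix N ν μ).map Complex.ofRealHom with hG
  set D : Matrix (Fin N) (Fin N) ℂ := Matrix.of fun n l =>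
    residueConst N ν μ n * (2 * (alpha μ : ℂ) ^ ((l : ℕ) + ν)) * d n l with hD
  have hDG : D * G = 1 := by
    ext n j
    rw [Matrix.mul_apply, Matrix.one_apply]
    have h := sum_residueConst_mul_gram ν hα hδ hlt n.2 j.2 (hd n n.2)
    rw [Finset.sum_range] at h
    simp only [Fin.ext_iff]
    rw [← h]
    rfl
  have hdet : IsUnit (gramMatrix N ν μ).det := by
    have h1 : IsUnit G.det := (Matrix.isUnit_iff_isUnit_det G).1 (IsUnit.of_mul_eq_one_right D hDG)
    rw [isUnit_iff_ne_zero] at h1 ⊢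
    intro h0
    apply h1
    rw [hG, ← RingHom.mapMatrix_apply, ← RingHom.map_det, h0, map_zero]
  have hinv : D = ((gramMatrix N ν μ)⁻¹).map Complex.ofRealHom := by
    have h1 : G * ((gramMatrix N ν μ)⁻¹).map Complex.ofRealHom = 1 := by
      rw [hG, ← Matrix.map_mul, Matrix.mul_nonsing_inv _ hdet]
      simp
    rw [← mul_one D, ← h1, ← mul_assoc, hDG, one_mul]
  rw [correlationKernel, Finset.sum_range]
  push_cast
  refine Finset.sum_congr rfl fun n _ => ?_
  rw [Finset.sum_range, Finset.mul_sum]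
  refine Finset.sum_congr rfl fun l _ => ?_
  have h := congr_fun (congr_fun hinv n) l
  simp only [hD, Matrix.of_apply, Matrix.map_apply, Complex.ofRealHom_eq_coe] at h
  rw [← h]
  ring

end CoupledGaussian

end

noncomputable section

namespace CoupledGaussian

open MeasureTheory Set Filter Topology

/-! ### The regularized hypergeometric function `₀F₁` -/

/-- The entire function `b ↦ ₀F₁(-; b | z) / Γ(b)`. -/
def regHyp0F1 (z b : ℂ) : ℂ := ∑' n : ℕ, z ^ n / n ! * (Complex.Gamma (b + n))⁻¹

theorem inv_Gamma_sub_natCast (s : ℂ) (r : ℕ) :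
    (Complex.Gamma (s - r))⁻¹ = falling r (s - 1) * (Complex.Gamma s)⁻¹ := by
  induction r with
  | zero => simp
  | succ r ih =>
    rw [Complex.one_div_Gamma_eq_self_mul_one_div_Gamma_add_one,
      show s - ((r + 1 : ℕ) : ℂ) + 1 = s - r by push_cast; ring, ih, falling_succ]
    push_cast; ring

theorem Gamma_sub_mul_inv_Gamma {s : ℂ} {r : ℕ} (h : Complex.Gamma (s - r) ≠ 0) :
    Complex.Gamma (s - r) * (Complex.Gamma s)⁻¹ = (falling r (s - 1))⁻¹ := by
  refine eq_inv_of_mul_eq_one_left ?_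
  rw [mul_assoc, mul_comm _ (falling r (s - 1)), ← inv_Gamma_sub_natCast, mul_inv_cancel₀ h]

theorem norm_inv_Gamma_add_le {b : ℂ} {n₀ : ℕ} (hb : ‖b‖ + 1 ≤ n₀) (i : ℕ) :
    ‖(Complex.Gamma (b + n₀ + i))⁻¹‖ ≤ ‖(Complex.Gamma (b + n₀))⁻¹‖ := by
  induction i with
  | zero => simp
  | succ i ih =>
    refine le_trans ?_ ih
    rw [Complex.one_div_Gamma_eq_self_mul_one_div_Gamma_add_one (b + n₀ + i), norm_mul,
      show b + n₀ + ((i + 1 : ℕ) : ℂ) = b + n₀ + i + 1 by push_cast; ring]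
    refine le_mul_of_one_le_left (norm_nonneg _) ?_
    have h1 : (n₀ : ℝ) + i ≤ ‖b + n₀ + i‖ + ‖b‖ := by
      have h2 : ‖((n₀ + i : ℕ) : ℂ)‖ ≤ ‖b + n₀ + i‖ + ‖b‖ := by
        have := norm_sub_le (b + n₀ + i) b
        rwa [show b + n₀ + i - b = ((n₀ + i : ℕ) : ℂ) by push_cast; ring] at this
      rw [Complex.norm_natCast] at h2
      exact_mod_cast h2
    have : (0 : ℝ) ≤ i := Nat.cast_nonneg i
    linarith

theorem differentiable_regHyp0F1 (z : ℂ) : Differentiable ℂ (regHyp0F1 z) := by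
  intro b₀
  obtain ⟨n₀, hn₀⟩ := exists_nat_ge (‖b₀‖ + 1 + 1)
  have hcont : Continuous fun b : ℂ => (Complex.Gamma b)⁻¹ :=
    Complex.differentiable_one_div_Gamma.continuous
  have hterm : ∀ n : ℕ, ∃ B : ℝ, ∀ b ∈ Metric.closedBall b₀ 1, ‖(Complex.Gamma (b + n))⁻¹‖ ≤ B :=
    fun n => (isCompact_closedBall b₀ 1).exists_bound_of_continuousOn
      (hcont.comp (continuous_add_const (n : ℂ))).continuousOn
  choose B hB using hterm
  have hbd : ∀ b ∈ Metric.ball b₀ 1, ∀ n, ‖z ^ n / n ! * (Complex.Gamma (b + n))⁻¹‖ ≤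
      ‖z‖ ^ n / n ! * (∑ i ∈ Finset.range (n₀ + 1), |B i|) := by
    intro b hb n
    have hbc := Metric.ball_subset_closedBall hb
    rw [norm_mul, norm_div, norm_pow, Complex.norm_natCast]
    refine mul_le_mul_of_nonneg_left ?_ (by positivity)
    have hle : ∀ i ≤ n₀, ‖(Complex.Gamma (b + i))⁻¹‖ ≤ ∑ i ∈ Finset.range (n₀ + 1), |B i| := by
      intro i hi
      refine (hB i b hbc).trans ((le_abs_self _).trans ?_)
      exact Finset.single_le_sum (f := fun i => |B i|) (fun i _ => abs_nonneg _)
        (Finset.mem_range.2 (Nat.lt_succ_of_le hi))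
    rcases le_total n n₀ with h | h
    · exact hle n h
    · obtain ⟨i, rfl⟩ := Nat.exists_eq_add_of_le h
      have hbn : ‖b‖ + 1 ≤ n₀ := by
        have h1 : ‖b - b₀‖ < 1 := by simpa [dist_eq_norm] using hb
        have h2 := norm_le_norm_add_norm_sub' b b₀
        linarith
      have := norm_inv_Gamma_add_le hbn i
      rw [add_assoc, ← Nat.cast_add] at this
      exact this.trans (hle n₀ le_rfl)
  have hsum : Summable fun n : ℕ => ‖z‖ ^ n / n ! * (∑ i ∈ Finset.range (n₀ + 1), |B i|) :=
    (Real.summable_pow_div_factorial ‖z‖).mul_right _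
  have hd : DifferentiableOn ℂ (fun b => ∑' n : ℕ, z ^ n / n ! * (Complex.Gamma (b + n))⁻¹)
      (Metric.ball b₀ 1) := by
    refine Complex.differentiableOn_tsum_of_summable_norm hsum (fun n => ?_) Metric.isOpen_ball
      fun n b hb => hbd b hb n
    refine Differentiable.differentiableOn ?_
    exact (Complex.differentiable_one_div_Gamma.comp (differentiable_id.add_const _)).const_mul _
  exact hd.differentiableAt (Metric.ball_mem_nhds b₀ one_pos)

theorem hyp0F1_mul_inv_Gamma {b : ℂ} (hb : ∀ k : ℕ, b ≠ -k) (z : ℂ) :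
    hyp0F1 b z * (Complex.Gamma b)⁻¹ = regHyp0F1 z b := by
  rw [hyp0F1, regHyp0F1, ← tsum_mul_right]
  refine tsum_congr fun n => ?_
  have h0 := Complex.Gamma_ne_zero hb
  rw [← Complex.Gamma_add_nat_div_Gamma_eq b hb]
  field_simp

theorem pow_mul_regHyp0F1 {μ : ℝ} (hδ : 0 < delta μ) (n : ℕ) {x : ℝ} (hx : 0 < x) :
    (x : ℂ) ^ n * regHyp0F1 ((delta μ ^ 2 * x : ℝ) : ℂ) (n + 1) =
      ((delta μ : ℂ) ^ n)⁻¹ * psi μ n x := by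
  have hδ' : (delta μ : ℂ) ≠ 0 := by exact_mod_cast hδ.ne'
  rw [psi_eq_tsum μ n hx, regHyp0F1, Complex.ofReal_tsum, ← tsum_mul_left, ← tsum_mul_left]
  refine tsum_congr fun m => ?_
  rw [show (n : ℂ) + 1 + m = ((m + n : ℕ) : ℂ) + 1 by push_cast; ring,
    Complex.Gamma_nat_eq_factorial]
  push_cast
  rw [mul_pow, ← pow_mul, pow_add, pow_add]
  field_simp

/-! ### The integrand -/

/-- The part of the integrand that depends on `t` only, without its poles. -/
def outerFactor (ν : ℕ) (μ x : ℝ) (t : ℂ) : ℂ :=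
  regHyp0F1 ((delta μ ^ 2 * x : ℝ) : ℂ) (t + 1) * (Complex.Gamma (t + ν + 1))⁻¹ *
    ((1 - delta μ ^ 2 / alpha μ ^ 2 : ℝ) : ℂ) ^ ν *
    ((alpha μ ^ 2 - delta μ ^ 2 : ℝ) : ℂ) ^ (t + 1) * (x : ℂ) ^ t

theorem differentiable_outerFactor (ν : ℕ) {μ x : ℝ} (hpos : 0 < alpha μ ^ 2 - delta μ ^ 2)
    (hx : 0 < x) : Differentiable ℂ (outerFactor ν μ x) := by
  have h1 : Differentiable ℂ fun t : ℂ => regHyp0F1 ((delta μ ^ 2 * x : ℝ) : ℂ) (t + 1) :=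
    (differentiable_regHyp0F1 _).comp (differentiable_id.add_const 1)
  have h2 : Differentiable ℂ fun t : ℂ => (Complex.Gamma (t + ν + 1))⁻¹ :=
    Complex.differentiable_one_div_Gamma.comp
      ((differentiable_id.add_const (ν : ℂ)).add_const 1)
  have h3 : Differentiable ℂ fun t : ℂ => ((alpha μ ^ 2 - delta μ ^ 2 : ℝ) : ℂ) ^ (t + 1) :=
    fun t => (differentiableAt_id.add_const 1).const_cpow (Or.inl (by exact_mod_cast hpos.ne'))
  have h4 : Differentiable ℂ fun t : ℂ => (x : ℂ) ^ t :=
    fun t => differentiableAt_id.const_cpow (Or.inl (by exact_mod_cast hx.ne'))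
  exact (((h1.mul h2).mul_const _).mul h3).mul h4

theorem outerFactor_natCast (ν : ℕ) {μ x : ℝ} (hδ : 0 < delta μ) (hx : 0 < x) (N n : ℕ) :
    outerFactor ν μ x n * ((-1) ^ (N - 1 - n) * (n ! * (N - 1 - n)! : ℂ))⁻¹ =
      residueConst N ν μ n * psi μ n x := by
  have h := pow_mul_regHyp0F1 hδ n hx
  rw [outerFactor, residueConst, Complex.cpow_natCast,
    show (n : ℂ) + ν + 1 = ((n + ν : ℕ) : ℂ) + 1 by push_cast; ring,
    Complex.Gamma_nat_eq_factorial, show (n : ℂ) + 1 = ((n + 1 : ℕ) : ℂ) by push_cast; ring,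
    Complex.cpow_natCast]
  push_cast at h ⊢
  simp only [mul_inv]
  linear_combination ((n + ν)! : ℂ)⁻¹ *
    (1 - (delta μ : ℂ) ^ 2 / (alpha μ : ℂ) ^ 2) ^ ν *
    ((alpha μ : ℂ) ^ 2 - (delta μ : ℂ) ^ 2) ^ (n + 1) *
    (((-1) ^ (N - 1 - n))⁻¹ * ((n ! : ℂ)⁻¹ * ((N - 1 - n)! : ℂ)⁻¹)) * h

/-- The part of the integrand that depends on `s`. -/
def innerFactor (N ν : ℕ) (μ : ℝ) (k m : ℕ) (y : ℝ) (t s : ℂ) : ℂ :=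
  falling (N - m) (s - 1) * Complex.Gamma s * (Complex.Gamma (s + (ν + k : ℕ)) *
    ((alpha μ ^ 2 * y : ℝ) : ℂ) ^ (-s) * (falling (k - m + 1) (s - 1 + k - t))⁻¹)

theorem kernelIntegrand_eq {N ν : ℕ} {μ : ℝ} {k m : ℕ} {x y : ℝ} {t s : ℂ} (hk : k < N)
    (hm : m ≤ k) (hs : 0 < s.re) (ht : ∀ i : ℕ, t ≠ -((i : ℂ) + 1)) (htN : ∀ n < N, t ≠ (n : ℂ))
    (hst : s.im ≠ t.im) :
    kernelIntegrand N ν μ k m x y t s =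
      outerFactor ν μ x t * (∏ j ∈ Finset.range N, (t - j))⁻¹ *
        innerFactor N ν μ k m y t s := by
  have hs0 := Complex.Gamma_ne_zero_of_re_pos hs
  have hmN : m ≤ N := by omega
  have h1 : Complex.Gamma s * (Complex.Gamma (s - N + m))⁻¹ = falling (N - m) (s - 1) := by
    rw [show s - N + m = s - ((N - m : ℕ) : ℂ) by rw [Nat.cast_sub hmN]; ring,
      inv_Gamma_sub_natCast, mul_left_comm, mul_inv_cancel₀ hs0, mul_one]
  have h2 : Complex.Gamma (s - t + m - 1) * (Complex.Gamma (s - t + k))⁻¹ =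
      (falling (k - m + 1) (s - 1 + k - t))⁻¹ := by
    have e : s - t + m - 1 = s - t + k - ((k - m + 1 : ℕ) : ℂ) := by
      push_cast [Nat.cast_sub hm]; ring
    rw [e, show s - 1 + k - t = s - t + k - 1 by ring]
    refine Gamma_sub_mul_inv_Gamma ?_
    rw [← e]
    refine Complex.Gamma_ne_zero fun i hi => hst ?_
    have := congr_arg Complex.im hi
    simp at this
    linarith
  have h3 : Complex.Gamma (t - N + 1) * (Complex.Gamma (t + 1))⁻¹ =
      (∏ j ∈ Finset.range N, (t - j))⁻¹ := by
    rw [show t - N + 1 = t + 1 - N by ring, ← falling_eq_prod]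
    have : t = t + 1 - 1 := by ring
    conv_rhs => rw [this]
    refine Gamma_sub_mul_inv_Gamma (Complex.Gamma_ne_zero fun i hi => ?_)
    by_cases h : i < N
    · refine htN (N - 1 - i) (by omega) ?_
      have e : ((N - 1 - i : ℕ) : ℂ) + i + 1 = N := by
        exact_mod_cast (by omega : N - 1 - i + i + 1 = N)
      linear_combination hi - e
    · refine ht (i - N) ?_
      rw [Nat.cast_sub (by omega)]
      linear_combination hi
  have h4 := hyp0F1_mul_inv_Gamma (b := t + 1) (fun i hi => ht i (by linear_combination hi))
    ((delta μ ^ 2 * x : ℝ) : ℂ)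
  rw [kernelIntegrand, outerFactor, innerFactor, ← h1, ← h2, ← h3, ← h4, Nat.cast_add,
    ← add_assoc s]
  simp only [div_eq_mul_inv, mul_inv]
  ring

theorem kernelIntegrand_eq_zero {N ν : ℕ} {μ : ℝ} {k m : ℕ} {x y : ℝ} {t : ℂ} {i : ℕ}
    (ht : t = -((i : ℂ) + 1)) (s : ℂ) : kernelIntegrand N ν μ k m x y t s = 0 := by
  have h : Complex.Gamma (t + 1) = 0 := by
    rw [ht, show -((i : ℂ) + 1) + 1 = -i by ring]
    exact Complex.Gamma_neg_nat_eq_zero i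
  simp [kernelIntegrand, h]

/-! ### The inner integral -/

theorem falling_continuous (r : ℕ) : Continuous (falling r) :=
  (descPochhammer ℂ r).continuous

theorem hasDerivAt_inv_falling (r : ℕ) {a t : ℂ} (h : ∀ i < r, a - t - i ≠ 0) :
    HasDerivAt (fun t => (falling r (a - t))⁻¹)
      ((falling r (a - t))⁻¹ * ∑ i ∈ Finset.range r, (a - t - i)⁻¹) t := by
  induction r with
  | zero => simpa using hasDerivAt_const t (1 : ℂ)
  | succ r ih =>
    have h1 := ih fun i hi => h i (by omega)
    have h0 := h r (by omega)
    have h2 : HasDerivAt (fun t : ℂ => (a - t - r)⁻¹) ((a - t - r)⁻¹ * (a - t - r)⁻¹) t := by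
      have := (((hasDerivAt_id t).const_sub a).sub_const (r : ℂ)).inv h0
      refine this.congr_deriv ?_
      rw [neg_neg, pow_two, one_div, mul_inv]
      rfl
    have h3 := h1.mul h2
    simp only [falling_succ, mul_inv]
    refine h3.congr_deriv ?_
    rw [Finset.sum_range_succ]
    ring

theorem norm_inv_falling_le (r : ℕ) {a : ℂ} {ε : ℝ} (hε : 0 < ε) (h : ∀ i < r, ε ≤ ‖a - i‖) :
    ‖(falling r a)⁻¹‖ ≤ ε⁻¹ ^ r := by
  rw [falling_eq_prod, norm_inv, norm_prod, ← Finset.prod_inv_distrib]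
  refine (Finset.prod_le_prod (fun i _ => by positivity) fun i hi => ?_).trans
    (by rw [Finset.prod_const, Finset.card_range])
  exact inv_anti₀ hε (h i (Finset.mem_range.1 hi))

theorem le_norm_of_ball_subset_sameSide {N : ℕ} {c : ℝ} {p t₀ t : ℂ} {ε : ℝ}
    (hball : Metric.ball t₀ (2 * ε) ⊆ sameSide N c p) (ht : t ∈ Metric.ball t₀ ε) (v : ℝ) {j : ℕ}
    (hj : j < N) : ε ≤ ‖(c : ℂ) + v * Complex.I - 1 + j - t‖ := by
  have hre : ε ≤ |c - 1 + j - t.re| := by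
    by_contra! hlt
    have hmem : t + ((c - 1 + j - t.re : ℝ) : ℂ) ∈ Metric.ball t₀ (2 * ε) := by
      rw [Metric.mem_ball, dist_eq_norm] at ht ⊢
      calc ‖t + ((c - 1 + j - t.re : ℝ) : ℂ) - t₀‖
          = ‖(t - t₀) + ((c - 1 + j - t.re : ℝ) : ℂ)‖ := by congr 1; ring
        _ ≤ ‖t - t₀‖ + ‖((c - 1 + j - t.re : ℝ) : ℂ)‖ := norm_add_le _ _
        _ < ε + ε := by
          rw [Complex.norm_real]
          exact add_lt_add ht hlt
        _ = 2 * ε := by ring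
    refine re_ne_of_mem_sameSide (hball hmem) hj ?_
    rw [Complex.add_re, Complex.ofReal_re]
    ring
  refine hre.trans ?_
  have h := Complex.abs_re_le_norm ((c : ℂ) + v * Complex.I - 1 + j - t)
  simpa using h

theorem le_norm_shift_of_ball_subset_sameSide {N : ℕ} {c : ℝ} {p t₀ t : ℂ} {ε : ℝ}
    (hball : Metric.ball t₀ (2 * ε) ⊆ sameSide N c p) (ht : t ∈ Metric.ball t₀ ε) (v : ℝ)
    {k m : ℕ} (hk : k < N) :
    ∀ i < k - m + 1, m ≤ k → ε ≤ ‖(c : ℂ) + v * Complex.I - 1 + k - t - i‖ := by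
  intro i hi hm
  have h := le_norm_of_ball_subset_sameSide hball ht v (j := k - i) (by omega)
  rw [Nat.cast_sub (by omega)] at h
  convert h using 2
  ring

theorem exists_ball_subset_sameSide {N : ℕ} {c : ℝ} {p t₀ : ℂ} (ht₀ : t₀ ∈ sameSide N c p) :
    ∃ ε > 0, Metric.ball t₀ (2 * ε) ⊆ sameSide N c p := by
  obtain ⟨η, hη, h⟩ := Metric.isOpen_iff.1 (isOpen_sameSide N c p) t₀ ht₀
  exact ⟨η / 2, half_pos hη, by rwa [mul_div_cancel₀ _ two_ne_zero]⟩

theorem continuous_inv_falling_vertical {c : ℝ} {a : ℂ} {r : ℕ}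
    (h : ∀ v : ℝ, ∀ i < r, (c : ℂ) + v * Complex.I + a - i ≠ 0) :
    Continuous fun v : ℝ => (falling r ((c : ℂ) + v * Complex.I + a))⁻¹ := by
  refine Continuous.inv₀ ((falling_continuous r).comp (by fun_prop)) fun v => ?_
  rw [falling_eq_prod, Finset.prod_ne_zero_iff]
  exact fun i hi => h v i (Finset.mem_range.1 hi)

theorem eval_comp_X_sub_one (r : ℕ) (s : ℂ) :
    ((descPochhammer ℂ r).comp (Polynomial.X - 1)).eval s = falling r (s - 1) := by
  simp [falling]

theorem integrable_innerFactor_mul {N ν : ℕ} {μ : ℝ} (hα : 0 < alpha μ) (m κ : ℕ) {y c : ℝ}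
    (hy : 0 < y) (hc : 0 < c) {g : ℝ → ℂ} (hg : Continuous g) {B : ℝ} (hB : ∀ v, ‖g v‖ ≤ B) :
    Integrable fun v : ℝ => falling (N - m) ((c : ℂ) + v * Complex.I - 1) *
      Complex.Gamma ((c : ℂ) + v * Complex.I) *
        (Complex.Gamma ((c : ℂ) + v * Complex.I + (ν + κ : ℕ)) *
          ((alpha μ ^ 2 * y : ℝ) : ℂ) ^ (-((c : ℂ) + v * Complex.I)) * g v) := by
  have h := integrable_eval_mul_Gamma_mul_Gamma
    ((descPochhammer ℂ (N - m)).comp (Polynomial.X - 1)) (ν + κ) hc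
    (by positivity : 0 < alpha μ ^ 2 * y) hg.aestronglyMeasurable hB
  simpa only [eval_comp_X_sub_one] using h

theorem innerIntegral {N ν : ℕ} {μ : ℝ} (hα : 0 < alpha μ) {k m : ℕ} (hk : k < N) (hm : m ≤ k)
    {y c : ℝ} (hy : 0 < y) (hc : 0 < c) {p t₀ : ℂ} (ht₀ : t₀ ∈ sameSide N c p) :
    Integrable (fun v : ℝ => innerFactor N ν μ k m y t₀ (c + v * Complex.I)) ∧
    DifferentiableAt ℂ (fun t => ∫ v : ℝ, innerFactor N ν μ k m y t (c + v * Complex.I)) t₀ := by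
  obtain ⟨ε, hε, hball⟩ := exists_ball_subset_sameSide ht₀
  set r := k - m + 1 with hr
  have hlow : ∀ t ∈ Metric.ball t₀ ε, ∀ v : ℝ, ∀ i < r,
      ε ≤ ‖(c : ℂ) + v * Complex.I - 1 + k - t - i‖ := fun t ht v i hi =>
    le_norm_shift_of_ball_subset_sameSide hball ht v hk i hi hm
  have hne : ∀ t ∈ Metric.ball t₀ ε, ∀ v : ℝ, ∀ i < r,
      (c : ℂ) + v * Complex.I - 1 + k - t - i ≠ 0 := fun t ht v i hi =>
    norm_pos_iff.1 (hε.trans_le (hlow t ht v i hi))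
  have hcont : ∀ t ∈ Metric.ball t₀ ε, Continuous fun v : ℝ =>
      (falling r ((c : ℂ) + v * Complex.I - 1 + k - t))⁻¹ := by
    intro t ht
    have h := continuous_inv_falling_vertical (c := c) (a := -1 + k - t) (r := r)
      fun v i hi => by
        have := hne t ht v i hi
        rwa [show (c : ℂ) + v * Complex.I + (-1 + k - t) - i =
          (c : ℂ) + v * Complex.I - 1 + k - t - i by ring]
    refine h.congr fun v => ?_
    congr 2; ring
  have hbd : ∀ t ∈ Metric.ball t₀ ε, ∀ v : ℝ,
      ‖(falling r ((c : ℂ) + v * Complex.I - 1 + k - t))⁻¹‖ ≤ ε⁻¹ ^ r := fun t ht v =>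
    norm_inv_falling_le r hε (hlow t ht v)
  have hint : ∀ t ∈ Metric.ball t₀ ε,
      Integrable (fun v : ℝ => innerFactor N ν μ k m y t (c + v * Complex.I)) := fun t ht =>
    integrable_innerFactor_mul hα m k hy hc (hcont t ht) (hbd t ht)
  have hmem : t₀ ∈ Metric.ball t₀ ε := Metric.mem_ball_self hε
  refine ⟨hint t₀ hmem, ?_⟩
  set Φ : ℝ → ℂ := fun v => falling (N - m) ((c : ℂ) + v * Complex.I - 1) *
      Complex.Gamma ((c : ℂ) + v * Complex.I) *
        (Complex.Gamma ((c : ℂ) + v * Complex.I + (ν + k : ℕ)) *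
          ((alpha μ ^ 2 * y : ℝ) : ℂ) ^ (-((c : ℂ) + v * Complex.I))) with hΦ
  have hΦi : Integrable Φ := by
    have h := integrable_innerFactor_mul (N := N) (ν := ν) hα m k hy hc (g := fun _ => 1)
      continuous_const (B := 1) (by simp)
    simpa only [mul_one] using h
  have hsum : ∀ t ∈ Metric.ball t₀ ε, ∀ v : ℝ,
      ‖∑ i ∈ Finset.range r, ((c : ℂ) + v * Complex.I - 1 + k - t - i)⁻¹‖ ≤ r * ε⁻¹ := by
    intro t ht v
    refine (norm_sum_le _ _).trans ((Finset.sum_le_card_nsmul _ _ ε⁻¹ fun i hi => ?_).trans ?_)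
    · rw [norm_inv]
      exact inv_anti₀ hε (hlow t ht v i (Finset.mem_range.1 hi))
    · simp
  have key := hasDerivAt_integral_of_dominated_loc_of_deriv_le
    (μ := volume) (F := fun t (v : ℝ) => innerFactor N ν μ k m y t (c + v * Complex.I))
    (F' := fun t (v : ℝ) => Φ v * ((falling r ((c : ℂ) + v * Complex.I - 1 + k - t))⁻¹ *
      ∑ i ∈ Finset.range r, ((c : ℂ) + v * Complex.I - 1 + k - t - i)⁻¹))
    (x₀ := t₀) (s := Metric.ball t₀ ε) (bound := fun v => ‖Φ v‖ * (ε⁻¹ ^ r * (r * ε⁻¹)))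
    (Metric.ball_mem_nhds t₀ hε) ?_ (hint t₀ hmem) ?_ ?_ ?_ ?_
  · exact key.2.differentiableAt
  · filter_upwards [Metric.ball_mem_nhds t₀ hε] with t ht
    exact (hint t ht).aestronglyMeasurable
  · refine hΦi.aestronglyMeasurable.mul (Continuous.aestronglyMeasurable ?_)
    refine (hcont t₀ hmem).mul (continuous_finsetSum _ fun i hi => ?_)
    exact Continuous.inv₀ (by fun_prop) fun v => hne t₀ hmem v i (Finset.mem_range.1 hi)
  · refine Eventually.of_forall fun v t ht => ?_
    rw [norm_mul, norm_mul (falling _ _)⁻¹]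
    gcongr
    · exact hbd t ht v
    · exact hsum t ht v
  · exact hΦi.norm.mul_const _
  · refine Eventually.of_forall fun v t ht => ?_
    have h := (hasDerivAt_inv_falling r (hne t ht v)).const_mul (Φ v)
    refine h.congr_of_eventuallyEq (Eventually.of_forall fun t' => ?_)
    simp only [hΦ, innerFactor, ← hr]
    ring

end CoupledGaussian

end

noncomputable section

namespace CoupledGaussian

open MeasureTheory Set Filter Topology

/-! ### The contour integrals in terms of residues -/

theorem alpha_pos {μ : ℝ} (hμ₀ : 0 < μ) : 0 < alpha μ := by
  unfold alpha; positivity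

theorem delta_pos {μ : ℝ} (hμ₀ : 0 < μ) (hμ₁ : μ < 1) : 0 < delta μ :=
  div_pos (by linarith) (by linarith)

theorem delta_lt_alpha {μ : ℝ} (hμ₀ : 0 < μ) : delta μ < alpha μ :=
  div_lt_div_of_pos_right (by linarith) (by linarith)

/-- The integrand of the `t`-integral, without its poles. -/
def residueFun (N ν : ℕ) (μ : ℝ) (c : ℝ) (k m : ℕ) (x y : ℝ) (t : ℂ) : ℂ :=
  outerFactor ν μ x t * verticalIntegral c (innerFactor N ν μ k m y t)

theorem differentiableOn_residueFun {N ν : ℕ} {μ : ℝ} (hα : 0 < alpha μ)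
    (hpos : 0 < alpha μ ^ 2 - delta μ ^ 2) {k m : ℕ} (hk : k < N) (hm : m ≤ k)
    {x y c : ℝ} (hx : 0 < x) (hy : 0 < y) (hc : 0 < c) (p : ℂ) :
    DifferentiableOn ℂ (residueFun N ν μ c k m x y) (sameSide N c p) := fun t ht =>
  ((differentiable_outerFactor ν hpos hx t).mul
    ((innerIntegral hα hk hm hy hc ht).2.const_mul Complex.I)).differentiableWithinAt

theorem kernelIntegrand_ae_eq {N ν : ℕ} {μ : ℝ} {k m : ℕ} (hk : k < N) (hm : m ≤ k) {x y c : ℝ}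
    (hc : 0 < c) {t : ℂ} (ht : t ∉ range fun i : ℕ => -((i : ℂ) + 1))
    (htN : ∀ n < N, t ≠ (n : ℂ)) :
    (fun v : ℝ => kernelIntegrand N ν μ k m x y t (c + v * Complex.I)) =ᵐ[volume]
      fun v : ℝ => outerFactor ν μ x t * (∏ j ∈ Finset.range N, (t - j))⁻¹ *
        innerFactor N ν μ k m y t (c + v * Complex.I) := by
  filter_upwards [(countable_singleton t.im).ae_notMem volume] with v hv
  refine kernelIntegrand_eq hk hm (by simpa using hc) (fun i hi => ht ⟨i, hi.symm⟩) htN ?_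
  simpa using hv

theorem verticalIntegral_kernelIntegrand {N ν : ℕ} {μ : ℝ} {k m : ℕ} (hk : k < N) (hm : m ≤ k)
    {x y c : ℝ} (hc : 0 < c) {t : ℂ} (ht : t ∉ range fun i : ℕ => -((i : ℂ) + 1))
    (htN : ∀ n < N, t ≠ (n : ℂ)) :
    verticalIntegral c (fun s => kernelIntegrand N ν μ k m x y t s) =
      residueFun N ν μ c k m x y t * (∏ j ∈ Finset.range N, (t - j))⁻¹ := by
  rw [verticalIntegral, integral_congr_ae (kernelIntegrand_ae_eq hk hm hc ht htN),
    integral_const_mul, residueFun, verticalIntegral]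
  ring

theorem integrable_kernelIntegrand {N ν : ℕ} {μ : ℝ} (hα : 0 < alpha μ) {k m : ℕ} (hk : k < N)
    (hm : m ≤ k) {x y c : ℝ} (hy : 0 < y) (hc : 0 < c) {p t : ℂ} (htU : t ∈ sameSide N c p)
    (htN : ∀ n < N, t ≠ (n : ℂ)) :
    Integrable (fun v : ℝ => kernelIntegrand N ν μ k m x y t (c + v * Complex.I)) := by
  by_cases ht : t ∈ range fun i : ℕ => -((i : ℂ) + 1)
  · obtain ⟨i, rfl⟩ := ht
    simp_rw [kernelIntegrand_eq_zero (i := i) rfl]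
    exact integrable_zero _ _ _
  · exact ((innerIntegral hα hk hm hy hc htU).1.const_mul _).congr
      (kernelIntegrand_ae_eq hk hm hc ht htN).symm

theorem verticalIntegral_sum {ι : Type*} (s : Finset ι) {c : ℝ} (a : ι → ℂ) {f : ι → ℂ → ℂ}
    (hf : ∀ i ∈ s, Integrable fun v : ℝ => f i (c + v * Complex.I)) :
    verticalIntegral c (fun z => ∑ i ∈ s, a i * f i z) =
      ∑ i ∈ s, a i * verticalIntegral c (f i) := by
  simp only [verticalIntegral]
  rw [integral_finsetSum _ fun i hi => (hf i hi).const_mul (a i), Finset.mul_sum]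
  refine Finset.sum_congr rfl fun i _ => ?_
  rw [integral_const_mul]
  ring

theorem verticalIntegral_congr {c : ℝ} {f g : ℂ → ℂ} (h : ∀ s : ℂ, s.re = c → f s = g s) :
    verticalIntegral c f = verticalIntegral c g := by
  rw [verticalIntegral, verticalIntegral]
  congr 2
  ext v
  exact h _ (by simp)

theorem sum_verticalIntegral_innerFactor {N ν : ℕ} {μ : ℝ} (hα : 0 < alpha μ) {k n : ℕ}
    (hk : k < N) (hn : n < N) {y c : ℝ} (hy : 0 < y) (hc : 0 < c) {p : ℂ}
    (hnU : (n : ℂ) ∈ sameSide N c p) :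
    ∑ m ∈ Finset.range (k + 1), (-1) ^ m * (N.choose m : ℂ) *
        verticalIntegral c (innerFactor N ν μ k m y n) =
      verticalIntegral c (fun s => (residuePoly N n k).eval (s - 1) *
        (Complex.Gamma s * Complex.Gamma (s + (k + ν : ℕ)) *
          ((alpha μ ^ 2 * y : ℝ) : ℂ) ^ (-s))) := by
  rw [← verticalIntegral_sum]
  · refine verticalIntegral_congr fun s hs => ?_
    rw [eval_residuePoly hn hk (a := s - 1) (by simp [hs, hc]), Finset.sum_mul]
    · refine Finset.sum_congr rfl fun m _ => ?_
      rw [innerFactor, add_comm ν k]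
      ring
    · intro j hj h
      have h1 := congr_arg Complex.re h
      simp [hs] at h1
      refine re_ne_of_mem_sameSide hnU (lt_of_le_of_lt hj hk) ?_
      rw [Complex.natCast_re]
      linarith
  · intro m hm
    exact (innerIntegral hα hk (Nat.lt_succ_iff.1 (Finset.mem_range.1 hm)) hy hc hnU).1

theorem sum_verticalIntegral_residuePoly {N ν n : ℕ} {μ : ℝ} (hα : 0 < alpha μ) {y c : ℝ}
    (hy : 0 < y) (hc : 0 < c) {q : ℂ} {d : ℕ → ℂ}
    (hd : ∀ s, (mellinPoly N ν n q).eval s =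
      ∑ l ∈ Finset.range N, d l * (ascPochhammer ℂ l).eval (s + ν)) :
    ∑ k ∈ Finset.range N, q ^ k * verticalIntegral c
        (fun s => (residuePoly N n k).eval (s - 1) *
          (Complex.Gamma s * Complex.Gamma (s + (k + ν : ℕ)) *
            ((alpha μ ^ 2 * y : ℝ) : ℂ) ^ (-s))) =
      2 * Real.pi * Complex.I *
        ∑ l ∈ Finset.range N, d l * (2 * (alpha μ : ℂ) ^ (l + ν) * phi ν μ l y) := by
  have hr : 0 < alpha μ ^ 2 * y := by positivity
  have hΓ : ∀ (s : ℂ) (l : ℕ), s.re = c → Complex.Gamma (s + (l + ν : ℕ)) =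
      (ascPochhammer ℂ l).eval (s + ν) * Complex.Gamma (s + ν) := by
    intro s l hs
    have hre : 0 < (s + ν).re := by
      simp only [Complex.add_re, Complex.natCast_re, hs]
      positivity
    rw [← Complex.Gamma_add_nat_div_Gamma_eq (s + ν), div_mul_cancel₀ _
      (Complex.Gamma_ne_zero_of_re_pos hre), Nat.cast_add, add_comm (l : ℂ), add_assoc]
    intro i hi
    rw [hi] at hre
    simp at hre
    exact absurd hre (not_lt.2 (Nat.cast_nonneg i))
  rw [Finset.mul_sum]
  have h2 : ∑ l ∈ Finset.range N, 2 * Real.pi * Complex.I *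
      (d l * (2 * (alpha μ : ℂ) ^ (l + ν) * phi ν μ l y)) =
      ∑ l ∈ Finset.range N, d l * verticalIntegral c
        (fun s => Complex.Gamma s * Complex.Gamma (s + (l + ν : ℕ)) *
          ((alpha μ ^ 2 * y : ℝ) : ℂ) ^ (-s)) := by
    refine Finset.sum_congr rfl fun l _ => ?_
    rw [phi_eq_verticalIntegral ν hα l hy hc]
    ring
  rw [h2, ← verticalIntegral_sum, ← verticalIntegral_sum]
  · refine verticalIntegral_congr fun s hs => ?_
    have h3 := hd s
    rw [eval_mellinPoly] at h3
    have h4 := congr_arg (fun z => z * (Complex.Gamma s * Complex.Gamma (s + ν) *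
      ((alpha μ ^ 2 * y : ℝ) : ℂ) ^ (-s))) h3
    simp only [Finset.sum_mul] at h4
    convert h4 using 1
    · refine Finset.sum_congr rfl fun k _ => ?_
      rw [hΓ s k hs]; ring
    · refine Finset.sum_congr rfl fun k _ => ?_
      rw [hΓ s k hs]; ring
  · intro l _
    simpa using integrable_Gamma_mul_Gamma 1 (l + ν) hc hr
  · intro k _
    have h := integrable_Gamma_mul_Gamma ((residuePoly N n k).comp (Polynomial.X - 1)) (k + ν) hc hr
    simpa using h

theorem kernelCoeff_eq {N ν : ℕ} {μ : ℝ} (hα : 0 < alpha μ) (hδ : 0 < delta μ)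
    (hlt : delta μ < alpha μ) {p : ℂ} {γ : Path p p} (hγ : IsPiecewiseC1 γ)
    (hγN : ∀ n : ℕ, n < N → EncirclesOnce γ (n : ℂ)) {c : ℝ} (hc : 0 < c)
    (hsep : ∀ j : ℕ, j < N → ∀ u, (γ u).re ≠ c + j - 1) {x y : ℝ} (hx : 0 < x) (hy : 0 < y)
    {k : ℕ} (hk : k < N) :
    kernelCoeff N ν μ γ c k x y = (2 * Real.pi * Complex.I)⁻¹ * ∑ n ∈ Finset.range N,
      residueConst N ν μ n * psi μ n x * verticalIntegral c
        (fun s => (residuePoly N n k).eval (s - 1) *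
          (Complex.Gamma s * Complex.Gamma (s + (k + ν : ℕ)) *
            ((alpha μ ^ 2 * y : ℝ) : ℂ) ^ (-s))) := by
  have hpos : 0 < alpha μ ^ 2 - delta μ ^ 2 := sub_pos.2 (pow_lt_pow_left₀ hlt hδ.le two_ne_zero)
  have hγU := range_subset_sameSide hsep
  have hne : ∀ t ∈ range γ, ∀ n < N, t ≠ (n : ℂ) := by
    rintro t ht n hn rfl
    exact (hγN n hn).1 ht
  have hcontour : ∀ m ∈ Finset.range (k + 1),
      (-1) ^ m / (2 * Real.pi * Complex.I) ^ 2 * (N.choose m : ℂ) *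
        contourIntegral γ (fun t => verticalIntegral c fun s => kernelIntegrand N ν μ k m x y t s) =
      (2 * Real.pi * Complex.I)⁻¹ * ∑ n ∈ Finset.range N, residueConst N ν μ n * psi μ n x *
        ((-1) ^ m * (N.choose m : ℂ) * verticalIntegral c (innerFactor N ν μ k m y n)) := by
    intro m hm
    have hm' : m ≤ k := Nat.lt_succ_iff.1 (Finset.mem_range.1 hm)
    rw [contourIntegral_congr (countable_range fun i : ℕ => -((i : ℂ) + 1)) fun t ht htZ =>
        verticalIntegral_kernelIntegrand hk hm' hc htZ (hne t ht),
      contourIntegral_mul_inv_prod hγ (convex_sameSide N c p) (isOpen_sameSide N c p) hγU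
        (by omega) hγN (differentiableOn_residueFun hα hpos hk hm' hx hy hc p),
      Finset.mul_sum, Finset.mul_sum, Finset.mul_sum]
    refine Finset.sum_congr rfl fun n _ => ?_
    rw [← outerFactor_natCast ν hδ hx, residueFun]
    have := Complex.two_pi_I_ne_zero
    generalize ((-1 : ℂ) ^ (N - 1 - n) * (n ! * (N - 1 - n)! : ℂ))⁻¹ = w
    generalize 2 * (Real.pi : ℂ) * Complex.I = z at *
    field_simp
  rw [kernelCoeff, Finset.sum_congr rfl hcontour, ← Finset.mul_sum, Finset.sum_comm]
  congr 1
  refine Finset.sum_congr rfl fun n hn => ?_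
  rw [Finset.mem_range] at hn
  rw [← Finset.mul_sum, sum_verticalIntegral_innerFactor hα hk hn hy hc
    ((hγN n hn).mem_of_convex hγ (convex_sameSide N c p) (isOpen_sameSide N c p) hγU)]

end CoupledGaussian

end

open CoupledGaussian in
theorem mainTheorem8 (N ν : ℕ) (μ : ℝ) (hμ₀ : 0 < μ) (hμ₁ : μ < 1)
    (p : ℂ) (γ : Path p p) (hγ : IsPiecewiseC1 γ)
    (hγN : ∀ n : ℕ, n < N → EncirclesOnce γ (n : ℂ))
    (c : ℝ) (hc : 0 < c)
    (hsep : ∀ j : ℕ, j < N → ∀ u, (γ u).re ≠ c + j - 1)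
    (x y : ℝ) (hx : 0 < x) (hy : 0 < y) :
    (∀ k : ℕ, k < N → ∀ m : ℕ, m ≤ k →
      (∀ u, MeasureTheory.Integrable
        (fun v : ℝ => kernelIntegrand N ν μ k m x y (γ u) (c + v * Complex.I))) ∧
      CurveIntegrable
        (oneForm fun t => verticalIntegral c fun s => kernelIntegrand N ν μ k m x y t s) γ) ∧
    (correlationKernel N ν μ x y : ℂ) =
      ∑ k ∈ Finset.range N,
        kernelCoeff N ν μ γ c k x y * ((delta μ / alpha μ : ℝ) : ℂ) ^ (2 * k) := by
  have hα := alpha_pos hμ₀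
  have hδ := delta_pos hμ₀ hμ₁
  have hlt := delta_lt_alpha hμ₀
  have hpos : 0 < alpha μ ^ 2 - delta μ ^ 2 := sub_pos.2 (pow_lt_pow_left₀ hlt hδ.le two_ne_zero)
  have hγU := range_subset_sameSide hsep
  have hne : ∀ t ∈ Set.range γ, ∀ n < N, t ≠ (n : ℂ) := by
    rintro t ht n hn rfl
    exact (hγN n hn).1 ht
  refine ⟨fun k hk m hm => ⟨fun u => ?_, ?_⟩, ?_⟩
  · exact integrable_kernelIntegrand hα hk hm hy hc (hγU ⟨u, rfl⟩) (hne _ ⟨u, rfl⟩)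
  · refine curveIntegrable_congr (Set.countable_range fun i : ℕ => -((i : ℂ) + 1))
      (fun t ht htZ => verticalIntegral_kernelIntegrand hk hm hc htZ (hne t ht))
      (hγ.curveIntegrable (ContinuousOn.mul ?_ ?_))
    · exact (differentiableOn_residueFun hα hpos hk hm hx hy hc p).continuousOn.mono hγU
    · refine ContinuousOn.inv₀ (by fun_prop) fun t ht => ?_
      exact Finset.prod_ne_zero_iff.2 fun n hn =>
        sub_ne_zero.2 (hne t ht n (Finset.mem_range.1 hn))
  · have hd : ∀ n, ∃ d : ℕ → ℂ, n < N → ∀ s,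
        (mellinPoly N ν n ((delta μ / alpha μ : ℝ) ^ 2)).eval s =
          ∑ l ∈ Finset.range N, d l * (ascPochhammer ℂ l).eval (s + ν) := by
      intro n
      by_cases hn : n < N
      · obtain ⟨d, hd⟩ := exists_mellinPoly_eq_sum ν ((delta μ / alpha μ : ℝ) ^ 2 : ℂ) hn
        exact ⟨d, fun _ => hd⟩
      · exact ⟨0, fun h => absurd h hn⟩
    choose d hd using hd
    rw [correlationKernel_eq ν hα hδ hlt hd x y]
    have hk : ∀ k ∈ Finset.range N,
        kernelCoeff N ν μ γ c k x y * ((delta μ / alpha μ : ℝ) : ℂ) ^ (2 * k) =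
        ∑ n ∈ Finset.range N, (2 * Real.pi * Complex.I)⁻¹ * (residueConst N ν μ n * psi μ n x) *
          (((delta μ / alpha μ : ℝ) ^ 2 : ℂ) ^ k * verticalIntegral c
            (fun s => (residuePoly N n k).eval (s - 1) *
              (Complex.Gamma s * Complex.Gamma (s + (k + ν : ℕ)) *
                ((alpha μ ^ 2 * y : ℝ) : ℂ) ^ (-s)))) := by
      intro k hk
      rw [kernelCoeff_eq hα hδ hlt hγ hγN hc hsep hx hy (Finset.mem_range.1 hk), pow_mul,
        Finset.mul_sum, Finset.sum_mul]
      exact Finset.sum_congr rfl fun n _ => by ring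
    rw [Finset.sum_congr rfl hk, Finset.sum_comm]
    refine Finset.sum_congr rfl fun n hn => ?_
    rw [← Finset.mul_sum, sum_verticalIntegral_residuePoly hα hy hc (hd n (Finset.mem_range.1 hn))]
    have := Complex.two_pi_I_ne_zero
    field_simp
    exact congrArg _ (Finset.sum_congr rfl fun l _ => by ring)
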